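/- Let $n\ge 1$, let $\mathbb F$ be a field of characteristic zero and let $f=\sum_{\alpha\in\mathbb N^n}c_\alpha x^\alpha$ be a nonzero power series in $n$ variables over $\mathbb F$. Let $P=\operatorname{conv}\{\alpha\in\mathbb N^n: c_\alpha\neq 0\}+\mathbb R_{\ge 0}^n$ be its Newton polyhedron, and write $D=\mathbb R_{\ge 0}^n\setminus\{0\}$. For $w\in D$ let $\operatorname{face}(w)=\{\alpha\in P:\langle w,\alpha\rangle\le\langle w,\beta\rangle\ \forall\beta\in P\}$. Let $\Pi$ be the set of normal vectors of $P$, i.e. of all $v\in\mathbb N^n\setminus\{0\}$ whose entries have greatest common divisor $1$ and for which $\operatorname{face}(v)$ is a facet of $P$ (has dimension $n-1$). For $V\subset\mathbb R_{\ge 0}^n$ let $C(V)$ be the set of all nonzero linear combinations of elements of $V$ with nonnegative coefficients. For a vertex $a$ of $P$ (a point with $\{a\}=\operatorname{face}(w)$ for some $w\in D$) let $\Pi_a=\{v\in\Pi: a\in\operatorname{face}(v)\}$; the vertex cone of $a$ is $C_a=C(\Pi_a)$. A subcone $F$ of a cone $C\subseteq D$ is a face of $C$ if the section of $F$ by the hyperplane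 $x_1+\dots+x_n=1$ is a face of the section of $C$. A finite set of $k$-dimensional convex polyhedral (respectively simplicial) cones $C(V)$, $V\subset D$ finite, with union $K$ makes $K$ a $k$-dimensional polyhedral (respectively simplicial) fan if any two distinct ones with nonempty intersection meet in a common face. A unimodular refinement of $C_a$ is a finite collection $R_a$ of sets $S$ of vectors such that $\Pi_a$ is a minimal generator set of $C_a$, the cones $C(S)$, $S\in R_a$, make $C_a$ a simplicial fan of the same dimension as $C_a$, each $S\in R_a$ consists of the columns of an $n\times n$ matrix over $\mathbb N$ of determinant $\pm1$, and $\bigcup_{S\in R_a}S=\Pi_a\cup W_a$ for a finite set $W_a\subset C_a\cap\mathbb N^n$. The cones $C(S)$ with $S\in R_a$ are the refined vertex cones of $a$. A choice of a unimodular refinement $R_a$ for every vertex $a$ is called compatible if for all vertices $a,b$ the refinements $R_a$ and $R_b$ have the same cones inside $C_a\cap C_b$: a subset of $C_a\cap C_b$ is a face of some $C(S)$ with $S\in R_a$ if and only if it is a face of some $C(S)$ with $S\in R_b$. Then: (a) The set of vertex cones of $P$ is finite and makes $D$ an $n$-dimensional polyhedral fan: $D=\bigcup_a C_a$, each $C_a$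 is an $n$-dimensional convex polyhedral cone, and any two distinct vertex cones that meet do so in a common face. (b) A compatible choice of unimodular refinements of all the vertex cones exists. For every choice of unimodular refinements, $D$ is the union of all the refined vertex cones; and for every compatible choice the set of all refined vertex cones makes $D$ an $n$-dimensional simplicial fan. -/

import Mathlib

open scoped Pointwise Matrix

namespace NewtonFan

variable {n : ℕ}

noncomputable section

/-- Integer vectors with nonnegative entries, viewed in `ℝⁿ`. -/
def toReal (v : Fin n → ℕ) : Fin n → ℝ := fun i => (v i : ℝ)

/-- The ambient cone `ℝ≥0ⁿ \ {0}`. -/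
def ambientCone (n : ℕ) : Set (Fin n → ℝ) := {x | 0 ≤ x} \ {0}

/-- The set of exponents of the monomials of `f`, viewed in `ℝⁿ`. -/
def supp {𝕜 : Type*} [Field 𝕜] (f : MvPowerSeries (Fin n) 𝕜) : Set (Fin n → ℝ) :=
  {x | ∃ α : Fin n →₀ ℕ, MvPowerSeries.coeff α f ≠ 0 ∧ x = toReal α}

/-- The Newton polyhedron `conv (supp f) + ℝ≥0ⁿ`. -/
def newtonPolyhedron {𝕜 : Type*} [Field 𝕜] (f : MvPowerSeries (Fin n) 𝕜) :
    Set (Fin n → ℝ) :=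
  convexHull ℝ (supp f) + {x | 0 ≤ x}

/-- The points of `P` at which the linear form `⟨w, ·⟩` attains its minimum over `P`. -/
def face (P : Set (Fin n → ℝ)) (w : Fin n → ℝ) : Set (Fin n → ℝ) :=
  {α | α ∈ P ∧ ∀ β ∈ P, w ⬝ᵥ α ≤ w ⬝ᵥ β}

/-- The dimension of (the affine hull of) a set. -/
def affDim (s : Set (Fin n → ℝ)) : ℕ := Module.finrank ℝ (affineSpan ℝ s).direction

/-- The normal vectors of `P`: the vectors in `ℕⁿ` whose entries have greatest common divisor `1`
(in particular nonzero vectors) and whose associated face of `P` is a facet, i.e. has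
dimension `n - 1`. -/
def normalVectors (P : Set (Fin n → ℝ)) : Set (Fin n → ℝ) :=
  {x | ∃ v : Fin n → ℕ, x = toReal v ∧ Finset.univ.gcd v = 1 ∧
    (face P x).Nonempty ∧ affDim (face P x) + 1 = n}

/-- The vertices of `P`: the points `a` such that `{a}` is a face of `P` associated with a
nonzero vector with nonnegative entries. -/
def vertices (P : Set (Fin n → ℝ)) : Set (Fin n → ℝ) :=
  {a | ∃ w ∈ ambientCone n, face P w = {a}}

/-- The cone `C(V)`, with the origin removed, of all nonnegative combinations of elements
of `V`. -/
def coneOf (V : Set (Fin n → ℝ)) : Set (Fin n → ℝ) :=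
  (PointedCone.hull ℝ V : Set (Fin n → ℝ)) \ {0}

/-- The generator set of the vertex cone of `a`: the normal vectors whose facet contains `a`. -/
def vertexGenerators (P : Set (Fin n → ℝ)) (a : Fin n → ℝ) : Set (Fin n → ℝ) :=
  {v | v ∈ normalVectors P ∧ a ∈ face P v}

/-- The vertex cone of `a`. -/
def vertexCone (P : Set (Fin n → ℝ)) (a : Fin n → ℝ) : Set (Fin n → ℝ) :=
  coneOf (vertexGenerators P a)

/-- `C` is a `k`-dimensional convex polyhedral cone in the ambient cone. -/
def IsPolyhedralCone (k : ℕ) (C : Set (Fin n → ℝ)) : Prop :=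
  ∃ V : Set (Fin n → ℝ), V.Finite ∧ V ⊆ ambientCone n ∧ Set.finrank ℝ V = k ∧ C = coneOf V

/-- `C` is a `k`-dimensional simplicial cone in the ambient cone. -/
def IsSimplicialCone (k : ℕ) (C : Set (Fin n → ℝ)) : Prop :=
  1 ≤ k ∧ ∃ V : Set (Fin n → ℝ), V.Finite ∧ V ⊆ ambientCone n ∧
    V.ncard = k ∧ Set.finrank ℝ V = k ∧ C = coneOf V

/-- The section of a cone by the hyperplane `x₁ + ⋯ + xₙ = 1`. -/
def coneSection (C : Set (Fin n → ℝ)) : Set (Fin n → ℝ) := {x | x ∈ C ∧ ∑ i, x i = 1}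

/-- `F` is a (nonempty) face of the cone `C`: a subcone whose section is a face of the section
of `C`, i.e. the set of maximizers of a linear form on it. -/
def IsConeFace (F C : Set (Fin n → ℝ)) : Prop :=
  F.Nonempty ∧ F ⊆ C ∧ (∀ x ∈ F, ∀ t : ℝ, 0 < t → t • x ∈ F) ∧
    IsExposed ℝ (coneSection C) (coneSection F)

/-- Any two distinct cones of the collection that meet (the origin not being counted) meet in a
common face. -/
def MeetInFaces (𝒦 : Set (Set (Fin n → ℝ))) : Prop :=
  ∀ C ∈ 𝒦, ∀ D ∈ 𝒦, C ≠ D → (C ∩ D).Nonempty → IsConeFace (C ∩ D) C ∧ IsConeFace (C ∩ D) D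

/-- The collection of cones `𝒦` makes `K` a `k`-dimensional polyhedral fan. -/
def IsPolyhedralFan (k : ℕ) (𝒦 : Set (Set (Fin n → ℝ))) (K : Set (Fin n → ℝ)) : Prop :=
  𝒦.Finite ∧ (∀ C ∈ 𝒦, IsPolyhedralCone k C) ∧ K = ⋃₀ 𝒦 ∧ MeetInFaces 𝒦

/-- The collection of cones `𝒦` makes `K` a `k`-dimensional simplicial fan. -/
def IsSimplicialFan (k : ℕ) (𝒦 : Set (Set (Fin n → ℝ))) (K : Set (Fin n → ℝ)) : Prop :=
  𝒦.Finite ∧ (∀ C ∈ 𝒦, IsSimplicialCone k C) ∧ K = ⋃₀ 𝒦 ∧ MeetInFaces 𝒦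

/-- No element of `V` lies in the cone generated by the others. -/
def IsMinimalGenerators (V : Set (Fin n → ℝ)) : Prop := ∀ v ∈ V, v ∉ coneOf (V \ {v})

/-- A simplicial refinement of `C(V)`, where `V` is a minimal generator set, via the finite set
`W ⊆ C(V)` of auxiliary vectors. It is given by the collection `𝒱` of the generator sets of its
cones. -/
def IsSimplicialRefinement (V W : Set (Fin n → ℝ)) (𝒱 : Set (Set (Fin n → ℝ))) : Prop :=
  IsMinimalGenerators V ∧ W.Finite ∧ W ⊆ coneOf V ∧ 𝒱.Finite ∧
    IsSimplicialFan (Set.finrank ℝ V) (coneOf '' 𝒱) (coneOf V) ∧ ⋃₀ 𝒱 = V ∪ W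

/-- `S` consists of the columns of an `n × n` matrix with entries in `ℕ` and
determinant `1` or `-1`. -/
def IsUnimodular (S : Set (Fin n → ℝ)) : Prop :=
  ∃ v : Fin n → Fin n → ℕ, S = Set.range (fun j => toReal (v j)) ∧
    |(Matrix.of fun i j => (v j i : ℤ)).det| = 1

/-- `𝒱` is the collection of the generator sets of the refined vertex cones in a unimodular
simplicial refinement of the vertex cone of `a`, via auxiliary vectors in `ℕⁿ \ {0}`. -/
def IsVertexConeRefinement (P : Set (Fin n → ℝ)) (a : Fin n → ℝ)
    (𝒱 : Set (Set (Fin n → ℝ))) : Prop :=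
  (∃ W : Set (Fin n → ℝ), W ⊆ toReal '' {v : Fin n → ℕ | v ≠ 0} ∧
    IsSimplicialRefinement (vertexGenerators P a) W 𝒱) ∧ ∀ S ∈ 𝒱, IsUnimodular S

/-- A choice of a unimodular simplicial refinement for each vertex cone of `P`. -/
def IsRefinementChoice (P : Set (Fin n → ℝ))
    (R : (Fin n → ℝ) → Set (Set (Fin n → ℝ))) : Prop :=
  ∀ a ∈ vertices P, IsVertexConeRefinement P a (R a)

/-- The set of the faces, contained in `T`, of the cones with generator sets in `𝒱`. -/
def facesWithin (𝒱 : Set (Set (Fin n → ℝ))) (T : Set (Fin n → ℝ)) : Set (Set (Fin n → ℝ)) :=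
  {F | F ⊆ T ∧ ∃ S ∈ 𝒱, IsConeFace F (coneOf S)}

/-- The refinements of any two vertex cones subdivide their intersection in the same way. -/
def AgreeOnOverlaps (P : Set (Fin n → ℝ))
    (R : (Fin n → ℝ) → Set (Set (Fin n → ℝ))) : Prop :=
  ∀ a ∈ vertices P, ∀ b ∈ vertices P,
    facesWithin (R a) (vertexCone P a ∩ vertexCone P b) =
      facesWithin (R b) (vertexCone P a ∩ vertexCone P b)

/-- The set of all vertex cones. -/
def vertexCones (P : Set (Fin n → ℝ)) : Set (Set (Fin n → ℝ)) := vertexCone P '' vertices P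

/-- The set of all refined vertex cones, for the choice `R` of refinements. -/
def refinedVertexCones (P : Set (Fin n → ℝ))
    (R : (Fin n → ℝ) → Set (Set (Fin n → ℝ))) : Set (Set (Fin n → ℝ)) :=
  {C | ∃ a ∈ vertices P, ∃ S ∈ R a, C = coneOf S}

end

end NewtonFan

/-!
The proof rests on one complete fan of unimodular cones which refines the normal fan of the
Newton polyhedron `P`; both the description of the vertex cones and the existence of compatible
refinements are read off from it.

*Construction of the fan.* By Dickson's lemma only a finite set `A` of exponents matters for the
minima over `P` of linear forms with nonnegative coefficients. Starting from the cone of the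
standard basis, star subdivisions at rays `u + v`, where `u` and `v` generate a two-dimensional
cone, keep all cones unimodular. Subdividing where a form `ℓ = ⟨·, α - β⟩`, with `α` and `β` in `A`,
satisfies `ℓ u > 0 > ℓ v` and `ℓ u - ℓ v` is maximal, one reaches a fan none of whose cones is cut
by such a hyperplane (`exists_isUnimodularSubdivision`). On each cone of this fan a single element
of `A` is then minimal, and it is a vertex of `P` (`IsPolyhedronOf.exists_refinesNormalFan`).
That cones cover the ambient cone and meet in faces is expressed by existence and uniqueness of
nonnegative coefficients with support in the generator set of one cone, a property which is easily
followed through a star subdivision (`IsUnimodularSubdivision.starSubdivision`).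

*Vertex cones.* The normal cone of `P` at a vertex `a` is the union of the cones of the fan
contained in it, so it is generated by finitely many primitive vectors. The vectors of a minimal
generator set are normal vectors of facets, since `v` can be moved a little in both directions
along any vector orthogonal to the face of `v` (`IsPolyhedronOf.affDim_face_of_notMem`), and
conversely no normal vector of a facet can be omitted (`notMem_coneOf_of_facet`). Hence the
vertex cone of `a` is the normal cone of `P` at `a` (`RefinesNormalFan.vertexCone_eq`). The normal
cones at `a` and `b` meet where the form `⟨·, a - b⟩`, which is nonpositive on the first, vanishes.

*Refinements.* The cones of the fan in the vertex cones are compatible unimodular refinements. For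
an arbitrary compatible choice and cones `C(S)` and `C(T)` refining the vertex cones of `a` and
`b`, the set `C(S) ∩ C_b` is a face of `C(S)`, hence a face of a cone `C(T')` refining `C_b`. So
`C(S) ∩ C(T)` is a face of the common face of `C(T')` and `C(T)`
(`IsRefinementChoice.isConeFace_inter`).
-/

namespace NewtonFan

variable {n : ℕ}

/-! ### Cones and their faces -/

theorem mem_ambientCone {x : Fin n → ℝ} : x ∈ ambientCone n ↔ 0 ≤ x ∧ x ≠ 0 := Iff.rfl

theorem coneOf_mono {V W : Set (Fin n → ℝ)} (h : V ⊆ W) : coneOf V ⊆ coneOf W :=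
  fun _ hx => ⟨Submodule.span_mono h hx.1, hx.2⟩

theorem smul_mem_hull {V : Set (Fin n → ℝ)} {x : Fin n → ℝ} (hx : x ∈ PointedCone.hull ℝ V)
    {t : ℝ} (ht : 0 ≤ t) : t • x ∈ PointedCone.hull ℝ V :=
  Submodule.smul_mem (PointedCone.hull ℝ V) (⟨t, ht⟩ : {c : ℝ // 0 ≤ c}) hx

theorem smul_mem_coneOf {V : Set (Fin n → ℝ)} {x : Fin n → ℝ} (hx : x ∈ coneOf V)
    {t : ℝ} (ht : 0 < t) : t • x ∈ coneOf V :=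
  ⟨smul_mem_hull hx.1 ht.le, smul_ne_zero ht.ne' hx.2⟩

/-- Induction over the pointed cone generated by `V`, with real scalars. -/
theorem hull_induction {V : Set (Fin n → ℝ)} {p : (Fin n → ℝ) → Prop}
    (mem : ∀ v ∈ V, p v) (zero : p 0)
    (add : ∀ x y, x ∈ PointedCone.hull ℝ V → y ∈ PointedCone.hull ℝ V → p x → p y → p (x + y))
    (smul : ∀ (t : ℝ) (x : Fin n → ℝ), 0 ≤ t → x ∈ PointedCone.hull ℝ V → p x → p (t • x))
    {x : Fin n → ℝ} (hx : x ∈ PointedCone.hull ℝ V) : p x := by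
  induction hx using Submodule.span_induction with
  | mem v hv => exact mem v hv
  | zero => exact zero
  | add x y hx hy px py => exact add x y hx hy px py
  | smul c x hx px => exact smul c.1 x c.2 hx px

theorem hull_subset_nonneg {V : Set (Fin n → ℝ)} (hV : V ⊆ ambientCone n) {x : Fin n → ℝ}
    (hx : x ∈ PointedCone.hull ℝ V) : 0 ≤ x :=
  hull_induction (p := fun x => 0 ≤ x) (fun _ hv => (hV hv).1) le_rfl
    (fun _ _ _ _ => add_nonneg) (fun _ _ ht _ hx => smul_nonneg ht hx) hx

theorem coneOf_subset_ambientCone {V : Set (Fin n → ℝ)} (hV : V ⊆ ambientCone n) :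
    coneOf V ⊆ ambientCone n :=
  fun _ hx => ⟨hull_subset_nonneg hV hx.1, hx.2⟩

theorem subset_coneOf {V : Set (Fin n → ℝ)} (hV : V ⊆ ambientCone n) : V ⊆ coneOf V :=
  fun _ hv => ⟨PointedCone.subset_hull hv, (hV hv).2⟩

theorem nonpos_of_mem_hull {V : Set (Fin n → ℝ)} {l : (Fin n → ℝ) →ₗ[ℝ] ℝ}
    (hl : ∀ v ∈ V, l v ≤ 0) {x : Fin n → ℝ} (hx : x ∈ PointedCone.hull ℝ V) : l x ≤ 0 :=
  hull_induction hl (by simp) (fun x y _ _ h1 h2 => by rw [map_add]; linarith)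
    (fun t x ht _ h => by rw [map_smul]; exact mul_nonpos_of_nonneg_of_nonpos ht h) hx

theorem mem_hull_of_apply_eq_zero {V : Set (Fin n → ℝ)} {l : (Fin n → ℝ) →ₗ[ℝ] ℝ}
    (hl : ∀ v ∈ V, l v ≤ 0) {x : Fin n → ℝ} (hx : x ∈ PointedCone.hull ℝ V) (h0 : l x = 0) :
    x ∈ PointedCone.hull ℝ {v ∈ V | l v = 0} := by
  revert h0
  refine hull_induction (p := fun x => l x = 0 → x ∈ PointedCone.hull ℝ {v ∈ V | l v = 0})
    (fun v hv h => PointedCone.subset_hull ⟨hv, h⟩) (fun _ => zero_mem _) ?_ ?_ hx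
  · intro x y hx hy px py h
    have h1 := nonpos_of_mem_hull hl hx
    have h2 := nonpos_of_mem_hull hl hy
    rw [map_add] at h
    exact add_mem (px (by linarith)) (py (by linarith))
  · intro t x ht hx px h
    rcases ht.eq_or_lt with rfl | ht'
    · simp
    · rw [map_smul, smul_eq_mul, mul_eq_zero] at h
      exact smul_mem_hull (px (h.resolve_left ht'.ne')) ht

/-- A supporting hyperplane cuts out of `C(V)` the cone generated by the elements of `V` which
it contains. -/
theorem sep_coneOf_eq {V : Set (Fin n → ℝ)} {l : (Fin n → ℝ) →ₗ[ℝ] ℝ}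
    (hl : ∀ v ∈ V, l v ≤ 0) : {x ∈ coneOf V | l x = 0} = coneOf {v ∈ V | l v = 0} := by
  ext x
  constructor
  · rintro ⟨hx, h0⟩
    exact ⟨mem_hull_of_apply_eq_zero hl hx.1 h0, hx.2⟩
  · intro hx
    refine ⟨coneOf_mono (Set.sep_subset _ _) hx, ?_⟩
    exact hull_induction (p := fun x => l x = 0) (fun v hv => hv.2) (map_zero l)
      (fun x y _ _ h1 h2 => by rw [map_add, h1, h2, add_zero])
      (fun t x _ _ h => by rw [map_smul, h, smul_zero]) hx.1

theorem sum_pos_of_mem_ambientCone {x : Fin n → ℝ} (hx : x ∈ ambientCone n) : 0 < ∑ i, x i := by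
  rw [mem_ambientCone] at hx
  refine (Finset.sum_nonneg fun i _ => hx.1 i).lt_of_ne' fun h => hx.2 ?_
  ext i
  exact (Finset.sum_eq_zero_iff_of_nonneg fun i _ => hx.1 i).1 h i (Finset.mem_univ i)

/-- Homogeneous description of faces: subtracting from a linear form on the section its maximum
times the coordinate sum makes the maximal value `0`. -/
theorem isConeFace_iff {F C : Set (Fin n → ℝ)} (hC : C ⊆ ambientCone n)
    (hsmul : ∀ x ∈ C, ∀ t : ℝ, 0 < t → t • x ∈ C) :
    IsConeFace F C ↔ F.Nonempty ∧
      ∃ l : (Fin n → ℝ) →ₗ[ℝ] ℝ, (∀ x ∈ C, l x ≤ 0) ∧ F = {x ∈ C | l x = 0} := by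
  have normalize : ∀ x ∈ C, ∑ i, ((∑ j, x j)⁻¹ • x) i = 1 := fun x hx => by
    simp only [Pi.smul_apply, smul_eq_mul, ← Finset.mul_sum]
    exact inv_mul_cancel₀ (sum_pos_of_mem_ambientCone (hC hx)).ne'
  constructor
  · rintro ⟨hne, hFC, hFs, hexp⟩
    refine ⟨hne, ?_⟩
    obtain ⟨x₀, hx₀⟩ := hne
    have mem_section : ∀ x ∈ F, (∑ j, x j)⁻¹ • x ∈ coneSection F := fun x hx =>
      ⟨hFs x hx _ (inv_pos.2 (sum_pos_of_mem_ambientCone (hC (hFC hx)))), normalize x (hFC hx)⟩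
    obtain ⟨l, hl⟩ := hexp ⟨_, mem_section x₀ hx₀⟩
    obtain ⟨y₀, hy₀F⟩ : ∃ y₀, y₀ ∈ coneSection F := ⟨_, mem_section x₀ hx₀⟩
    let σ : (Fin n → ℝ) →ₗ[ℝ] ℝ := ∑ i, LinearMap.proj i
    have hσ : ∀ x, σ x = ∑ i, x i := fun x => by simp [σ]
    have hmax : ∀ x ∈ C, (l : (Fin n → ℝ) →ₗ[ℝ] ℝ) x - l y₀ * ∑ j, x j ≤ 0 := fun x hx => by
      have hs := sum_pos_of_mem_ambientCone (hC hx)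
      have h1 : y₀ ∈ {x ∈ coneSection C | ∀ y ∈ coneSection C, l y ≤ l x} := hl ▸ hy₀F
      have h2 := h1.2 ((∑ j, x j)⁻¹ • x) ⟨hsmul x hx _ (inv_pos.2 hs), normalize x hx⟩
      rw [map_smul, smul_eq_mul, inv_mul_le_iff₀ hs] at h2
      simp only [ContinuousLinearMap.coe_coe]
      linarith
    refine ⟨(l : (Fin n → ℝ) →ₗ[ℝ] ℝ) - l y₀ • σ, fun x hx => ?_, ?_⟩
    · simpa [hσ] using hmax x hx
    · ext x
      constructor
      · intro hx
        refine ⟨hFC hx, le_antisymm (by simpa [hσ] using hmax x (hFC hx)) ?_⟩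
        have hs := sum_pos_of_mem_ambientCone (hC (hFC hx))
        have h1 : (∑ j, x j)⁻¹ • x ∈ {x ∈ coneSection C | ∀ y ∈ coneSection C, l y ≤ l x} :=
          hl ▸ mem_section x hx
        have h2 := h1.2 y₀ ⟨hFC hy₀F.1, hy₀F.2⟩
        rw [map_smul, smul_eq_mul, le_inv_mul_iff₀ hs] at h2
        simp only [LinearMap.sub_apply, LinearMap.smul_apply, hσ, ContinuousLinearMap.coe_coe,
          smul_eq_mul]
        linarith
      · rintro ⟨hx, h0⟩
        have hs := sum_pos_of_mem_ambientCone (hC hx)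
        have hmem : (∑ j, x j)⁻¹ • x ∈ coneSection F := by
          rw [hl]
          refine ⟨⟨hsmul x hx _ (inv_pos.2 hs), normalize x hx⟩, fun y hy => ?_⟩
          have h1 := hmax y hy.1
          rw [hy.2] at h1
          simp only [LinearMap.sub_apply, LinearMap.smul_apply, hσ, ContinuousLinearMap.coe_coe,
            smul_eq_mul] at h0 h1
          rw [map_smul, smul_eq_mul, le_inv_mul_iff₀ hs]
          nlinarith
        have := hFs _ hmem.1 _ hs
        rwa [smul_inv_smul₀ hs.ne'] at this
  · rintro ⟨hne, l, hl, rfl⟩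
    refine ⟨hne, fun x hx => hx.1, fun x hx t ht => ⟨hsmul x hx.1 t ht, ?_⟩, ?_⟩
    · rw [map_smul, hx.2, smul_zero]
    · rintro ⟨y₀, hy₀⟩
      refine ⟨LinearMap.toContinuousLinearMap l, ?_⟩
      ext x
      constructor
      · rintro ⟨⟨hx, h0⟩, hs⟩
        exact ⟨⟨hx, hs⟩, fun y hy => by simpa [h0] using hl y hy.1⟩
      · rintro ⟨⟨hx, hs⟩, h⟩
        refine ⟨⟨hx, le_antisymm (hl x hx) ?_⟩, hs⟩
        have := h y₀ ⟨hy₀.1.1, hy₀.2⟩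
        simpa [hy₀.1.2] using this

theorem isConeFace_coneOf_iff {F V : Set (Fin n → ℝ)} (hV : V ⊆ ambientCone n) :
    IsConeFace F (coneOf V) ↔ F.Nonempty ∧
      ∃ l : (Fin n → ℝ) →ₗ[ℝ] ℝ, (∀ x ∈ coneOf V, l x ≤ 0) ∧ F = {x ∈ coneOf V | l x = 0} :=
  isConeFace_iff (coneOf_subset_ambientCone hV) fun _ hx _ ht => smul_mem_coneOf hx ht

/-- Faces of a finitely generated cone are generated by subsets of the generators. -/
theorem IsConeFace.exists_subset {F V : Set (Fin n → ℝ)} (hV : V ⊆ ambientCone n)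
    (h : IsConeFace F (coneOf V)) : ∃ A ⊆ V, F = coneOf A := by
  obtain ⟨-, l, hl, rfl⟩ := (isConeFace_coneOf_iff hV).1 h
  exact ⟨_, Set.sep_subset _ _, sep_coneOf_eq fun v hv => hl v (subset_coneOf hV hv)⟩

/-- Every subset of the generators of a simplicial cone generates a face. -/
theorem isConeFace_of_subset {A S : Set (Fin n → ℝ)} (hS : S ⊆ ambientCone n)
    (hli : LinearIndepOn ℝ id S) (hA : A ⊆ S) (hne : (coneOf A).Nonempty) :
    IsConeFace (coneOf A) (coneOf S) := by
  classical
  -- the linear form which vanishes on `A` and takes the value `-1` on the rest of `S`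
  let b := Module.Basis.extend hli
  let l : (Fin n → ℝ) →ₗ[ℝ] ℝ := b.constr ℝ fun v => if (v : Fin n → ℝ) ∈ A then 0 else -1
  have hlv : ∀ v ∈ S, l v = if v ∈ A then 0 else -1 := fun v hv => by
    have h1 := b.constr_basis ℝ (fun v => if (v : Fin n → ℝ) ∈ A then (0 : ℝ) else -1)
      ⟨v, hli.subset_extend (Set.subset_univ S) hv⟩
    rwa [Module.Basis.extend_apply_self] at h1
  have hl : ∀ v ∈ S, l v ≤ 0 := fun v hv => by
    rw [hlv v hv]; split_ifs <;> norm_num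
  refine (isConeFace_coneOf_iff hS).2
    ⟨hne, l, fun x hx => nonpos_of_mem_hull hl hx.1, ?_⟩
  rw [sep_coneOf_eq hl]
  congr 1
  ext v
  constructor
  · intro hv
    exact ⟨hA hv, by rw [hlv v (hA hv), if_pos hv]⟩
  · rintro ⟨hv, h0⟩
    rw [hlv v hv] at h0
    by_contra hvA
    rw [if_neg hvA] at h0
    norm_num at h0

/-- A face of a face of a simplicial cone is a face, for faces given by supporting linear
forms. -/
theorem isConeFace_sep_sep {S : Set (Fin n → ℝ)} (hS : S ⊆ ambientCone n)
    (hli : LinearIndepOn ℝ id S) {l₁ l₂ : (Fin n → ℝ) →ₗ[ℝ] ℝ} (h₁ : ∀ x ∈ coneOf S, l₁ x ≤ 0)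
    (h₂ : ∀ x ∈ coneOf S, l₁ x = 0 → l₂ x ≤ 0)
    (hne : {x ∈ {x ∈ coneOf S | l₁ x = 0} | l₂ x = 0}.Nonempty) :
    IsConeFace {x ∈ {x ∈ coneOf S | l₁ x = 0} | l₂ x = 0} (coneOf S) := by
  have e₁ := sep_coneOf_eq fun v hv => h₁ v (subset_coneOf hS hv)
  have hsub : {v ∈ S | l₁ v = 0} ⊆ S := Set.sep_subset _ _
  have e₂ := sep_coneOf_eq (V := {v ∈ S | l₁ v = 0}) (l := l₂)
    fun v hv => h₂ v (subset_coneOf hS hv.1) hv.2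
  rw [e₁, e₂] at hne ⊢
  exact isConeFace_of_subset hS hli ((Set.sep_subset _ _).trans hsub) hne

/-! ### Unimodular sets of vectors -/

theorem toReal_injective : Function.Injective (toReal : (Fin n → ℕ) → Fin n → ℝ) :=
  fun v w h => funext fun i => by simpa [toReal] using congrFun h i

theorem toReal_add (u v : Fin n → ℕ) : toReal (u + v) = toReal u + toReal v :=
  funext fun i => by simp [toReal]

theorem toReal_zero : toReal (0 : Fin n → ℕ) = 0 := funext fun i => by simp [toReal]

theorem toReal_nonneg (v : Fin n → ℕ) : 0 ≤ toReal v := fun i => Nat.cast_nonneg (v i)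

theorem toReal_mem_ambientCone {v : Fin n → ℕ} (hv : v ≠ 0) : toReal v ∈ ambientCone n :=
  ⟨toReal_nonneg v, fun h => hv (toReal_injective (h.trans toReal_zero.symm))⟩

theorem linearIndependent_toReal {v : Fin n → Fin n → ℕ}
    (hv : |(Matrix.of fun i j => (v j i : ℤ)).det| = 1) :
    LinearIndependent ℝ fun j => toReal (v j) := by
  have h1 : LinearIndependent ℝ
      ((Matrix.of fun i j => (v j i : ℤ)).map (Int.castRingHom ℝ))ᵀ.row := by
    rw [Matrix.linearIndependent_rows_iff_isUnit, Matrix.isUnit_iff_isUnit_det,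
      Matrix.det_transpose, ← RingHom.mapMatrix_apply, ← RingHom.map_det]
    refine IsUnit.map _ (Int.isUnit_iff_abs_eq.2 hv)
  exact h1

namespace IsUnimodular

variable {S : Set (Fin n → ℝ)}

theorem linearIndepOn (h : IsUnimodular S) : LinearIndepOn ℝ id S := by
  obtain ⟨v, rfl, hv⟩ := h
  exact (linearIndependent_toReal hv).linearIndepOn_id

theorem finite (h : IsUnimodular S) : S.Finite := by
  obtain ⟨v, rfl, hv⟩ := h
  exact Set.finite_range _

theorem ncard_eq (h : IsUnimodular S) : S.ncard = n := by
  obtain ⟨v, rfl, hv⟩ := h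
  rw [Set.ncard_range_of_injective (linearIndependent_toReal hv).injective, Nat.card_fin]

theorem span_eq_top (h : IsUnimodular S) : Submodule.span ℝ S = ⊤ := by
  obtain ⟨v, rfl, hv⟩ := h
  exact (linearIndependent_toReal hv).span_eq_top_of_card_eq_finrank' (by simp)

theorem finrank_eq (h : IsUnimodular S) : Set.finrank ℝ S = n := by
  rw [Set.finrank, h.span_eq_top, finrank_top, Module.finrank_fin_fun]

theorem subset_toReal (h : IsUnimodular S) : S ⊆ toReal '' {v : Fin n → ℕ | v ≠ 0} := by
  obtain ⟨v, rfl, hv⟩ := h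
  rintro _ ⟨j, rfl⟩
  refine ⟨v j, fun h0 => (linearIndependent_toReal hv).ne_zero j ?_, rfl⟩
  rw [h0, toReal_zero]

theorem subset_ambientCone (h : IsUnimodular S) : S ⊆ ambientCone n := fun x hx => by
  obtain ⟨v, hv, rfl⟩ := h.subset_toReal hx
  exact toReal_mem_ambientCone hv

/-- The greatest common divisor of a column divides the determinant. -/
theorem gcd_eq_one (h : IsUnimodular S) {w : Fin n → ℕ} (hw : toReal w ∈ S) :
    Finset.univ.gcd w = 1 := by
  obtain ⟨v, rfl, hv⟩ := h
  obtain ⟨j, hj⟩ := hw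
  obtain rfl := toReal_injective hj
  have hdvd : ((Finset.univ.gcd (v j) : ℕ) : ℤ) ∣ (Matrix.of fun i j => (v j i : ℤ)).det := by
    have h1 : (Matrix.of fun i j => (v j i : ℤ)).det = ∑ i,
        (Matrix.of fun i j => (v j i : ℤ)).adjugate j i * (v j i : ℤ) := by
      have := congrFun (congrFun
        (Matrix.adjugate_mul (Matrix.of fun i j => (v j i : ℤ))) j) j
      simpa [Matrix.mul_apply] using this.symm
    rw [h1]
    exact Finset.dvd_sum fun i _ => Dvd.dvd.mul_left
      (Int.natCast_dvd_natCast.2 (Finset.gcd_dvd (Finset.mem_univ i))) _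
  have h3 := Int.isUnit_iff_natAbs_eq.1 (isUnit_of_dvd_unit hdvd (Int.isUnit_iff_abs_eq.2 hv))
  simpa using h3

/-- The cone generated by a basis is closed: its points are those with nonnegative
coordinates. -/
theorem isClosed_hull (h : IsUnimodular S) :
    IsClosed (PointedCone.hull ℝ S : Set (Fin n → ℝ)) := by
  have hspan := h.span_eq_top
  obtain ⟨v, rfl, hv⟩ := h
  have hli := linearIndependent_toReal hv
  let b := Module.Basis.mk hli hspan.ge
  have hb : ∀ j, b j = toReal (v j) := fun j => Module.Basis.mk_apply hli hspan.ge j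
  have hset : (PointedCone.hull ℝ (Set.range fun j => toReal (v j)) : Set (Fin n → ℝ)) =
      ⋂ j, {x | 0 ≤ b.coord j x} := by
    ext x
    simp only [Set.mem_iInter, Set.mem_ofPred_eq, SetLike.mem_coe]
    constructor
    · intro hx j
      refine hull_induction (p := fun x => 0 ≤ b.coord j x) ?_ (by simp)
        (fun x y _ _ h1 h2 => by rw [map_add]; exact add_nonneg h1 h2)
        (fun t x ht _ h1 => by rw [map_smul]; exact mul_nonneg ht h1) hx
      rintro _ ⟨i, rfl⟩
      change 0 ≤ b.coord j (toReal (v i))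
      rw [← hb i, Module.Basis.coord_apply, Module.Basis.repr_self]
      exact Finsupp.single_nonneg.2 zero_le_one j
    · intro hx
      rw [← b.sum_repr x]
      refine sum_mem fun j _ => smul_mem_hull (PointedCone.subset_hull ?_) (hx j)
      exact ⟨j, (hb j).symm⟩
  rw [hset]
  exact isClosed_iInter fun j => isClosed_le continuous_const
    (LinearMap.continuous_of_finiteDimensional (b.coord j))

end IsUnimodular

theorem isUnimodular_image_iff {T : Set (Fin n → ℕ)} :
    IsUnimodular (toReal '' T) ↔ ∃ v : Fin n → Fin n → ℕ, T = Set.range v ∧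
      |(Matrix.of fun i j => (v j i : ℤ)).det| = 1 := by
  refine exists_congr fun v => and_congr_left fun _ => ?_
  rw [show (Set.range fun j => toReal (v j)) = toReal '' Set.range v from
    Set.range_comp toReal v]
  exact toReal_injective.image_injective.eq_iff

/-! ### Unimodular subdivisions of the ambient cone -/

/-- The point with coefficients `c`. -/
noncomputable def comb : ((Fin n → ℕ) →₀ ℝ) →ₗ[ℝ] (Fin n → ℝ) :=
  Finsupp.linearCombination ℝ toReal

theorem comb_single (v : Fin n → ℕ) (t : ℝ) : comb (Finsupp.single v t) = t • toReal v := by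
  simp [comb]

/-- `c` is a family of nonnegative coefficients supported on one of the sets in `Δ`. -/
def IsCoeff (Δ : Finset (Finset (Fin n → ℕ))) (c : (Fin n → ℕ) →₀ ℝ) : Prop :=
  (∀ v, 0 ≤ c v) ∧ ∃ S ∈ Δ, ∀ v, c v ≠ 0 → v ∈ S

/-- `Δ` is the collection of the generator sets of the maximal cones of a complete unimodular fan
in the ambient cone. That the cones cover the ambient cone and meet in faces is encoded as
existence and uniqueness of coefficients. -/
structure IsUnimodularSubdivision (Δ : Finset (Finset (Fin n → ℕ))) : Prop where
  isUnimodular : ∀ S ∈ Δ, IsUnimodular (toReal '' (S : Set (Fin n → ℕ)))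
  exists_coeff : ∀ x : Fin n → ℝ, 0 ≤ x → ∃ c, IsCoeff Δ c ∧ comb c = x
  coeff_unique : ∀ c d, IsCoeff Δ c → IsCoeff Δ d → comb c = comb d → c = d

/-- The star subdivision at the ray through `u + v`: each maximal cone containing the
two-dimensional cone generated by `u` and `v` is cut into two. -/
def starSubdivision (u v : Fin n → ℕ) (Δ : Finset (Finset (Fin n → ℕ))) :
    Finset (Finset (Fin n → ℕ)) :=
  Δ.filter (fun S => ¬(u ∈ S ∧ v ∈ S)) ∪
    ((Δ.filter fun S => u ∈ S ∧ v ∈ S).image (fun S => insert (u + v) (S.erase u)) ∪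
      (Δ.filter fun S => u ∈ S ∧ v ∈ S).image (fun S => insert (u + v) (S.erase v)))

theorem mem_starSubdivision {u v : Fin n → ℕ} {Δ : Finset (Finset (Fin n → ℕ))}
    {T : Finset (Fin n → ℕ)} : T ∈ starSubdivision u v Δ ↔ (T ∈ Δ ∧ ¬(u ∈ T ∧ v ∈ T)) ∨
      ∃ S ∈ Δ, u ∈ S ∧ v ∈ S ∧
        (T = insert (u + v) (S.erase u) ∨ T = insert (u + v) (S.erase v)) := by
  simp only [starSubdivision, Finset.mem_union, Finset.mem_filter, Finset.mem_image]
  constructor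
  · rintro (h | ⟨S, ⟨h1, h2, h3⟩, rfl⟩ | ⟨S, ⟨h1, h2, h3⟩, rfl⟩)
    · exact Or.inl h
    · exact Or.inr ⟨S, h1, h2, h3, Or.inl rfl⟩
    · exact Or.inr ⟨S, h1, h2, h3, Or.inr rfl⟩
  · rintro (h | ⟨S, h1, h2, h3, rfl | rfl⟩)
    · exact Or.inl h
    · exact Or.inr (Or.inl ⟨S, ⟨h1, h2, h3⟩, rfl⟩)
    · exact Or.inr (Or.inr ⟨S, ⟨h1, h2, h3⟩, rfl⟩)

theorem isUnimodular_insert_erase {S : Finset (Fin n → ℕ)}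
    (hS : IsUnimodular (toReal '' (S : Set (Fin n → ℕ)))) {u v : Fin n → ℕ} (hu : u ∈ S)
    (hv : v ∈ S) (huv : u ≠ v) :
    IsUnimodular (toReal ''
      ((insert (u + v) (S.erase u) : Finset (Fin n → ℕ)) : Set (Fin n → ℕ))) := by
  rw [isUnimodular_image_iff] at hS ⊢
  obtain ⟨w, hw, hdet⟩ := hS
  have hinj : Function.Injective w := fun i j hij =>
    (linearIndependent_toReal hdet).injective (congrArg toReal hij)
  obtain ⟨i, rfl⟩ : u ∈ Set.range w := hw ▸ hu
  obtain ⟨j, rfl⟩ : v ∈ Set.range w := hw ▸ hv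
  have hij : i ≠ j := fun h => huv (congrArg w h)
  refine ⟨Function.update w i (w i + w j), ?_, ?_⟩
  · ext x
    have hx : x ∈ S ↔ ∃ k, w k = x := by rw [← Finset.mem_coe, hw, Set.mem_range]
    simp only [Finset.coe_insert, Finset.coe_erase, Set.mem_insert_iff, Set.mem_sdiff,
      Finset.mem_coe, Set.mem_singleton_iff, Set.mem_range, hx]
    constructor
    · rintro (rfl | ⟨⟨k, rfl⟩, hk⟩)
      · exact ⟨i, Function.update_self ..⟩
      · exact ⟨k, Function.update_of_ne (fun h => hk (congrArg w h)) ..⟩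
    · rintro ⟨k, rfl⟩
      by_cases hk : k = i
      · subst hk
        exact Or.inl (Function.update_self ..)
      · rw [Function.update_of_ne hk]
        exact Or.inr ⟨⟨k, rfl⟩, fun h => hk (hinj h)⟩
  · rw [← hdet, ← Matrix.det_updateCol_add_self (Matrix.of fun i j => (w j i : ℤ)) hij]
    congr 2
    ext a b
    by_cases hb : b = i
    · subst hb; simp
    · simp [hb]

namespace IsUnimodularSubdivision

variable {Δ : Finset (Finset (Fin n → ℕ))}

theorem ne_zero (hΔ : IsUnimodularSubdivision Δ) {S : Finset (Fin n → ℕ)} (hS : S ∈ Δ)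
    {v : Fin n → ℕ} (hv : v ∈ S) : v ≠ 0 := fun h => by
  have := (hΔ.isUnimodular S hS).subset_ambientCone ⟨v, hv, rfl⟩
  rw [h, toReal_zero] at this
  exact this.2 rfl

/-- If `u` and `v` generate a cone, `u + v` cannot be a ray: it would have two families of
coefficients. -/
theorem add_notMem (hΔ : IsUnimodularSubdivision Δ) {S : Finset (Fin n → ℕ)} (hS : S ∈ Δ)
    {u v : Fin n → ℕ} (hu : u ∈ S) (hv : v ∈ S) {T : Finset (Fin n → ℕ)} (hT : T ∈ Δ) :
    u + v ∉ T := fun hw => by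
  classical
  have hu0 := hΔ.ne_zero hS hu
  have hv0 := hΔ.ne_zero hS hv
  have h := hΔ.coeff_unique (Finsupp.single (u + v) 1)
    (Finsupp.single u 1 + Finsupp.single v 1) ⟨?_, T, hT, ?_⟩ ⟨?_, S, hS, ?_⟩ ?_
  · have := DFunLike.congr_fun h (u + v)
    simp [hu0, hv0] at this
  · intro x
    exact Finsupp.single_nonneg.2 zero_le_one x
  · intro x hx
    by_contra hxT
    exact hx (Finsupp.single_eq_of_ne (fun h => hxT (h ▸ hw)))
  · intro x
    exact add_nonneg (Finsupp.single_nonneg.2 zero_le_one x)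
      (Finsupp.single_nonneg.2 zero_le_one x)
  · intro x hx
    by_contra hxS
    have hxu : x ≠ u := fun h => hxS (h ▸ hu)
    have hxv : x ≠ v := fun h => hxS (h ▸ hv)
    simp [hxu, hxv] at hx
  · simp [comb_single, toReal_add]

/-- Moving the coefficient of the new ray `u + v` to `u` and `v` turns coefficients for the star
subdivision into coefficients for `Δ`, and is reversible since `u` and `v` do not occur together
in the star subdivision. -/
theorem starSubdivision (hΔ : IsUnimodularSubdivision Δ) {u v : Fin n → ℕ} (huv : u ≠ v)
    (hS : ∃ S ∈ Δ, u ∈ S ∧ v ∈ S) : IsUnimodularSubdivision (starSubdivision u v Δ) := by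
  classical
  obtain ⟨S₀, hS₀, hu₀, hv₀⟩ := hS
  have hu0 := hΔ.ne_zero hS₀ hu₀
  have hv0 := hΔ.ne_zero hS₀ hv₀
  have hw : ∀ T ∈ Δ, u + v ∉ T := fun T hT => hΔ.add_notMem hS₀ hu₀ hv₀ hT
  -- adding a multiple of the relation `δ` shifts coefficients between `u + v` and `u`, `v`
  let δ : (Fin n → ℕ) →₀ ℝ :=
    Finsupp.single u 1 + Finsupp.single v 1 - Finsupp.single (u + v) 1
  have hδu : δ u = 1 := by simp [δ, huv.symm, hv0]
  have hδv : δ v = 1 := by simp [δ, huv, hu0]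
  have hδw : δ (u + v) = -1 := by simp [δ, hu0, hv0]
  have hδ : ∀ x, x ≠ u → x ≠ v → x ≠ u + v → δ x = 0 := fun x h1 h2 h3 => by
    simp [δ, h1.symm, h2.symm, h3.symm]
  have hcomb : comb δ = 0 := by simp [δ, comb_single, toReal_add]
  refine ⟨?_, ?_, ?_⟩
  · intro T hT
    rcases mem_starSubdivision.1 hT with ⟨h, -⟩ | ⟨S, hS, hu, hv, rfl | rfl⟩
    · exact hΔ.isUnimodular T h
    · exact isUnimodular_insert_erase (hΔ.isUnimodular S hS) hu hv huv
    · rw [add_comm]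
      exact isUnimodular_insert_erase (hΔ.isUnimodular S hS) hv hu huv.symm
  · intro x hx
    obtain ⟨c, ⟨hc, S, hS, hcS⟩, rfl⟩ := hΔ.exists_coeff x hx
    by_cases h : u ∈ S ∧ v ∈ S
    · obtain ⟨hu, hv⟩ := h
      have hcw : c (u + v) = 0 := by
        by_contra h0
        exact hw S hS (hcS _ h0)
      have hnn : ∀ m : ℝ, 0 ≤ m → m ≤ c u → m ≤ c v → ∀ x, 0 ≤ (c - m • δ) x := by
        intro m hm h1 h2 x
        rw [Finsupp.sub_apply, Finsupp.smul_apply, smul_eq_mul]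
        by_cases hxu : x = u
        · rw [hxu, hδu]; linarith
        by_cases hxv : x = v
        · rw [hxv, hδv]; linarith
        by_cases hxw : x = u + v
        · rw [hxw, hδw, hcw]; linarith
        rw [hδ x hxu hxv hxw, mul_zero, sub_zero]
        exact hc x
      have hsupp : ∀ m : ℝ, ∀ x, (c - m • δ) x ≠ 0 → x = u + v ∨ x ∈ S := by
        intro m x hx
        by_contra hcon
        push Not at hcon
        obtain ⟨hxw, hxS⟩ := hcon
        refine hx ?_
        rw [Finsupp.sub_apply, Finsupp.smul_apply,
          hδ x (fun h => hxS (h ▸ hu)) (fun h => hxS (h ▸ hv)) hxw]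
        by_contra h0
        simp only [smul_zero, sub_zero] at h0
        exact hxS (hcS x h0)
      -- shift the minimum of the coefficients of `u` and `v` to `u + v`
      rcases le_total (c u) (c v) with hle | hle
      · refine ⟨c - c u • δ, ⟨hnn _ (hc u) le_rfl hle, insert (u + v) (S.erase u),
          mem_starSubdivision.2 (Or.inr ⟨S, hS, hu, hv, Or.inl rfl⟩), fun x hx => ?_⟩,
          by rw [map_sub, map_smul, hcomb, smul_zero, sub_zero]⟩
        rw [Finset.mem_insert, Finset.mem_erase]
        refine (hsupp _ x hx).imp_right fun h => ⟨?_, h⟩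
        rintro rfl
        simp [hδu] at hx
      · refine ⟨c - c v • δ, ⟨hnn _ (hc v) hle le_rfl, insert (u + v) (S.erase v),
          mem_starSubdivision.2 (Or.inr ⟨S, hS, hu, hv, Or.inr rfl⟩), fun x hx => ?_⟩,
          by rw [map_sub, map_smul, hcomb, smul_zero, sub_zero]⟩
        rw [Finset.mem_insert, Finset.mem_erase]
        refine (hsupp _ x hx).imp_right fun h => ⟨?_, h⟩
        rintro rfl
        simp [hδv] at hx
    · exact ⟨c, ⟨hc, S, mem_starSubdivision.2 (Or.inl ⟨hS, h⟩), hcS⟩, rfl⟩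
  · have fold : ∀ c, IsCoeff (NewtonFan.starSubdivision u v Δ) c →
        IsCoeff Δ (c + c (u + v) • δ) ∧ (c u = 0 ∨ c v = 0) := by
      rintro c ⟨hc, T, hT, hcT⟩
      have hnn : ∀ x, 0 ≤ (c + c (u + v) • δ) x := by
        intro x
        rw [Finsupp.add_apply, Finsupp.smul_apply, smul_eq_mul]
        have := hc (u + v)
        by_cases hxu : x = u
        · rw [hxu, hδu]; linarith [hc u]
        by_cases hxv : x = v
        · rw [hxv, hδv]; linarith [hc v]
        by_cases hxw : x = u + v
        · rw [hxw, hδw]; linarith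
        rw [hδ x hxu hxv hxw, mul_zero, add_zero]
        exact hc x
      rcases mem_starSubdivision.1 hT with ⟨hTΔ, hnot⟩ | ⟨S, hS, hu, hv, hTS⟩
      · have hcw : c (u + v) = 0 := by
          by_contra h0
          exact hw T hTΔ (hcT _ h0)
        refine ⟨⟨hnn, T, hTΔ, fun x hx => ?_⟩, ?_⟩
        · rw [hcw, zero_smul, add_zero] at hx
          exact hcT x hx
        · by_contra hcon
          push Not at hcon
          exact hnot ⟨hcT u hcon.1, hcT v hcon.2⟩
      · refine ⟨⟨hnn, S, hS, fun x hx => ?_⟩, ?_⟩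
        · by_contra hxS
          have hxu : x ≠ u := fun h => hxS (h ▸ hu)
          have hxv : x ≠ v := fun h => hxS (h ▸ hv)
          refine hx ?_
          rw [Finsupp.add_apply, Finsupp.smul_apply, smul_eq_mul]
          by_cases hxw : x = u + v
          · rw [hxw, hδw]; ring
          · rw [hδ x hxu hxv hxw, mul_zero, add_zero]
            by_contra h0
            have := hcT x h0
            rcases hTS with rfl | rfl <;> simp [hxw, hxS] at this
        · rcases hTS with rfl | rfl
          · left
            by_contra h0
            have := hcT u h0
            simp [hv0] at this
          · right
            by_contra h0
            have := hcT v h0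
            simp [hu0] at this
    intro c d hc hd hcd
    obtain ⟨hc', hcuv⟩ := fold c hc
    obtain ⟨hd', hduv⟩ := fold d hd
    have heq := hΔ.coeff_unique _ _ hc' hd' (by
      rw [map_add comb, map_add comb, map_smul comb, map_smul comb, hcomb, smul_zero, smul_zero,
        hcd])
    have eu := DFunLike.congr_fun heq u
    have ev := DFunLike.congr_fun heq v
    simp only [Finsupp.add_apply, Finsupp.smul_apply, smul_eq_mul, hδu, hδv, mul_one] at eu ev
    -- both are the minimum of the shifted coefficients of `u` and `v`
    have hw' : c (u + v) = d (u + v) := by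
      have c1 := hc.1 u
      have c2 := hc.1 v
      have d1 := hd.1 u
      have d2 := hd.1 v
      rcases hcuv with h1 | h1 <;> rcases hduv with h2 | h2 <;> linarith
    rw [hw'] at heq
    exact add_right_cancel heq

end IsUnimodularSubdivision

/-- The ambient cone itself is a unimodular cone, generated by the standard basis. -/
theorem isUnimodularSubdivision_single : IsUnimodularSubdivision
    ({Finset.univ.image fun i => (Pi.single i 1 : Fin n → ℕ)} :
      Finset (Finset (Fin n → ℕ))) := by
  classical
  have hinj : Function.Injective fun i => (Pi.single i 1 : Fin n → ℕ) := fun i j h => by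
    by_contra hij
    have := congrFun h i
    simp [hij] at this
  have heval : ∀ c : (Fin n → ℕ) →₀ ℝ, (∀ v, c v ≠ 0 →
      v ∈ Finset.univ.image fun i => (Pi.single i 1 : Fin n → ℕ)) →
      ∀ i, comb c i = c (Pi.single i 1) := by
    intro c hc i
    have h1 : comb c = ∑ j, c (Pi.single j 1) • toReal (Pi.single j 1) := by
      rw [comb, Finsupp.linearCombination_apply, Finsupp.sum_of_support_subset c
        (s := Finset.univ.image fun i => (Pi.single i 1 : Fin n → ℕ))
        (fun v hv => hc v (Finsupp.mem_support_iff.1 hv)) _ (by simp),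
        Finset.sum_image hinj.injOn]
    rw [h1]
    simp [toReal, Pi.single_apply]
  refine ⟨?_, ?_, ?_⟩
  · intro S hS
    rw [Finset.mem_singleton] at hS
    subst hS
    rw [isUnimodular_image_iff]
    refine ⟨fun i => Pi.single i 1, by simp, ?_⟩
    have : (Matrix.of fun i j => (((Pi.single j 1 : Fin n → ℕ) i : ℕ) : ℤ)) = 1 := by
      ext i j
      simp [Matrix.one_apply, Pi.single_apply]
    rw [this]
    simp
  · intro x hx
    refine ⟨∑ i, Finsupp.single (Pi.single i 1) (x i), ⟨fun v => ?_, _,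
      Finset.mem_singleton_self _, fun v hv => ?_⟩, ?_⟩
    · rw [Finsupp.finsetSum_apply]
      exact Finset.sum_nonneg fun i _ => Finsupp.single_nonneg.2 (hx i) v
    · rw [Finsupp.finsetSum_apply] at hv
      obtain ⟨i, -, hi⟩ := Finset.exists_ne_zero_of_sum_ne_zero hv
      rw [Finsupp.single_apply_ne_zero] at hi
      exact Finset.mem_image.2 ⟨i, Finset.mem_univ i, hi.1.symm⟩
    · ext i
      simp [comb_single, toReal, Pi.single_apply]
  · rintro c d ⟨-, S, hS, hcS⟩ ⟨-, T, hT, hdT⟩ hcd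
    rw [Finset.mem_singleton] at hS hT
    subst hS hT
    ext v
    by_cases hv : v ∈ Finset.univ.image fun i => (Pi.single i 1 : Fin n → ℕ)
    · obtain ⟨i, -, rfl⟩ := Finset.mem_image.1 hv
      rw [← heval c hcS, ← heval d hdT, hcd]
    · rw [not_imp_comm.1 (hcS v) hv, not_imp_comm.1 (hdT v) hv]

/-! ### Subdividing along hyperplanes -/

/-- The form `ℓ` has a constant weak sign on each cone of `Δ`, i.e. its kernel cuts none of
them. -/
def HasConstantSigns (ℓ : (Fin n → ℕ) →+ ℤ) (Δ : Finset (Finset (Fin n → ℕ))) : Prop :=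
  ∀ S ∈ Δ, (∀ s ∈ S, 0 ≤ ℓ s) ∨ ∀ s ∈ S, ℓ s ≤ 0

theorem HasConstantSigns.starSubdivision {ℓ : (Fin n → ℕ) →+ ℤ}
    {Δ : Finset (Finset (Fin n → ℕ))} (h : HasConstantSigns ℓ Δ) (u v : Fin n → ℕ) :
    HasConstantSigns ℓ (starSubdivision u v Δ) := by
  intro T hT
  rcases mem_starSubdivision.1 hT with ⟨hTΔ, -⟩ | ⟨S, hS, hu, hv, hTS⟩
  · exact h T hTΔ
  · have hmem : ∀ s ∈ T, s = u + v ∨ s ∈ S := by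
      intro s hs
      rcases hTS with rfl | rfl <;> simp only [Finset.mem_insert, Finset.mem_erase] at hs <;>
        exact hs.imp_right And.right
    refine (h S hS).imp (fun h0 s hs => ?_) (fun h0 s hs => ?_) <;>
      rcases hmem s hs with rfl | hsS
    · rw [map_add]; exact add_nonneg (h0 u hu) (h0 v hv)
    · exact h0 s hsS
    · rw [map_add]; exact add_nonpos (h0 u hu) (h0 v hv)
    · exact h0 s hsS

/-- The pairs of rays, spanning a cone, which lie strictly on different sides of the kernel
of `ℓ`. -/
def cutPairs (ℓ : (Fin n → ℕ) →+ ℤ) (Δ : Finset (Finset (Fin n → ℕ))) :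
    Finset ((Fin n → ℕ) × (Fin n → ℕ)) :=
  (Δ.biUnion fun S => S ×ˢ S).filter fun p => 0 < ℓ p.1 ∧ ℓ p.2 < 0

theorem mem_cutPairs {ℓ : (Fin n → ℕ) →+ ℤ} {Δ : Finset (Finset (Fin n → ℕ))}
    {p : (Fin n → ℕ) × (Fin n → ℕ)} :
    p ∈ cutPairs ℓ Δ ↔ (∃ S ∈ Δ, p.1 ∈ S ∧ p.2 ∈ S) ∧ 0 < ℓ p.1 ∧ ℓ p.2 < 0 := by
  simp [cutPairs]

/-- After subdividing at a cut pair with maximal difference `M` of the values of `ℓ`, every new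
cut pair has a smaller difference. -/
theorem mem_cutPairs_starSubdivision {ℓ : (Fin n → ℕ) →+ ℤ} {Δ : Finset (Finset (Fin n → ℕ))}
    {u v : Fin n → ℕ} {M : ℤ} (huv : (u, v) ∈ cutPairs ℓ Δ) (hM : ℓ u - ℓ v = M)
    (hle : ∀ p ∈ cutPairs ℓ Δ, ℓ p.1 - ℓ p.2 ≤ M) {p : (Fin n → ℕ) × (Fin n → ℕ)}
    (hp : p ∈ cutPairs ℓ (starSubdivision u v Δ)) :
    ℓ p.1 - ℓ p.2 < M ∨ p ∈ (cutPairs ℓ Δ).erase (u, v) := by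
  obtain ⟨p, q⟩ := p
  obtain ⟨-, hu0, hv0⟩ := mem_cutPairs.1 huv
  obtain ⟨⟨T, hT, hpT, hqT⟩, hp0, hq0⟩ := mem_cutPairs.1 hp
  dsimp only at *
  rcases mem_starSubdivision.1 hT with ⟨hTΔ, hnot⟩ | ⟨S, hS, hu, hv, hTS⟩
  · refine Or.inr (Finset.mem_erase.2 ⟨?_, mem_cutPairs.2 ⟨⟨T, hTΔ, hpT, hqT⟩, hp0, hq0⟩⟩)
    rintro h
    obtain ⟨rfl, rfl⟩ := Prod.mk.inj h
    exact hnot ⟨hpT, hqT⟩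
  · have hmem : ∀ s ∈ T, s = u + v ∨ s ∈ S := by
      intro s hs
      rcases hTS with rfl | rfl <;> simp only [Finset.mem_insert, Finset.mem_erase] at hs <;>
        exact hs.imp_right And.right
    rcases hmem p hpT with rfl | hpS
    · left
      rw [map_add] at hp0 ⊢
      rcases hmem q hqT with rfl | hqS
      · rw [map_add] at hq0; omega
      · have := hle (u, q) (mem_cutPairs.2 ⟨⟨S, hS, hu, hqS⟩, hu0, hq0⟩)
        dsimp only at this
        omega
    · rcases hmem q hqT with rfl | hqS
      · left
        rw [map_add] at hq0 ⊢
        have := hle (p, v) (mem_cutPairs.2 ⟨⟨S, hS, hpS, hv⟩, hp0, hv0⟩)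
        dsimp only at this
        omega
      · by_cases hpq : (p, q) = (u, v)
        · obtain ⟨rfl, rfl⟩ := Prod.mk.inj hpq
          left
          -- one of the two rays has been removed, so it can only be the new ray `p + q`
          rcases hTS with rfl | rfl
          · have h1 : p = p + q := by simpa using hpT
            have h2 := congrArg ℓ h1
            rw [map_add] at h2; omega
          · have h1 : q = p + q := by simpa using hqT
            have h2 := congrArg ℓ h1
            rw [map_add] at h2; omega
        · exact Or.inr (Finset.mem_erase.2
            ⟨hpq, mem_cutPairs.2 ⟨⟨S, hS, hpS, hqS⟩, hp0, hq0⟩⟩)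

/-- Termination of the star subdivisions at cut pairs with maximal difference: the maximal
difference, or else the number of pairs where it is attained, drops. -/
theorem exists_hasConstantSigns_of_le {ℓ : (Fin n → ℕ) →+ ℤ} (M : ℕ) :
    ∀ Δ : Finset (Finset (Fin n → ℕ)), IsUnimodularSubdivision Δ →
      (∀ p ∈ cutPairs ℓ Δ, ℓ p.1 - ℓ p.2 ≤ M) →
      ∃ Δ', IsUnimodularSubdivision Δ' ∧ HasConstantSigns ℓ Δ' ∧
        ∀ ℓ' : (Fin n → ℕ) →+ ℤ, HasConstantSigns ℓ' Δ → HasConstantSigns ℓ' Δ' := by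
  induction M with
  | zero =>
    intro Δ hΔ hle
    refine ⟨Δ, hΔ, fun S hS => ?_, fun _ h => h⟩
    by_contra! hcon
    obtain ⟨⟨q, hq, hq0⟩, p, hp, hp0⟩ := hcon
    have := hle (p, q) (mem_cutPairs.2 ⟨⟨S, hS, hp, hq⟩, hp0, hq0⟩)
    dsimp only at this
    omega
  | succ M ih =>
    suffices H : ∀ k : ℕ, ∀ Δ : Finset (Finset (Fin n → ℕ)), IsUnimodularSubdivision Δ →
        (∀ p ∈ cutPairs ℓ Δ, ℓ p.1 - ℓ p.2 ≤ (M + 1 : ℕ)) →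
        ((cutPairs ℓ Δ).filter fun p => ℓ p.1 - ℓ p.2 = (M + 1 : ℕ)).card ≤ k →
        ∃ Δ', IsUnimodularSubdivision Δ' ∧ HasConstantSigns ℓ Δ' ∧
          ∀ ℓ' : (Fin n → ℕ) →+ ℤ, HasConstantSigns ℓ' Δ → HasConstantSigns ℓ' Δ' from
      fun Δ hΔ hle => H _ Δ hΔ hle le_rfl
    intro k
    induction k with
    | zero =>
      intro Δ hΔ hle hcard
      refine ih Δ hΔ fun p hp => ?_
      have h1 := hle p hp
      have h2 : ℓ p.1 - ℓ p.2 ≠ (M + 1 : ℕ) :=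
        Finset.filter_eq_empty_iff.1 (Finset.card_eq_zero.1 (Nat.le_zero.1 hcard)) hp
      push_cast at h1 h2
      omega
    | succ k ihk =>
      intro Δ hΔ hle hcard
      by_cases hex : ∃ p ∈ cutPairs ℓ Δ, ℓ p.1 - ℓ p.2 = (M + 1 : ℕ)
      · obtain ⟨⟨u, v⟩, huv, hM⟩ := hex
        have hcut := mem_cutPairs.1 huv
        have hne : u ≠ v := by
          rintro rfl
          exact lt_asymm hcut.2.1 hcut.2.2
        have hnew := fun p (hp : p ∈ cutPairs ℓ (starSubdivision u v Δ)) =>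
          mem_cutPairs_starSubdivision huv hM hle hp
        have hcard' : ((cutPairs ℓ (starSubdivision u v Δ)).filter
            fun p => ℓ p.1 - ℓ p.2 = (M + 1 : ℕ)).card ≤ k := by
          refine Nat.le_of_lt_succ (lt_of_lt_of_le (Finset.card_lt_card ?_) hcard)
          rw [Finset.ssubset_iff_of_subset]
          · refine ⟨(u, v), Finset.mem_filter.2 ⟨huv, hM⟩, fun h => ?_⟩
            obtain ⟨h1, h2⟩ := Finset.mem_filter.1 h
            exact (hnew _ h1).elim (fun h3 => h3.ne h2) fun h3 => by simp at h3
          · intro p hp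
            obtain ⟨h1, h2⟩ := Finset.mem_filter.1 hp
            exact Finset.mem_filter.2 ⟨(hnew p h1).elim (fun h3 => absurd h2 h3.ne)
              Finset.mem_of_mem_erase, h2⟩
        obtain ⟨Δ', h1, h2, h3⟩ := ihk (starSubdivision u v Δ) (hΔ.starSubdivision hne hcut.1)
          (fun p hp => (hnew p hp).elim le_of_lt fun h => hle p (Finset.mem_of_mem_erase h))
          hcard'
        exact ⟨Δ', h1, h2, fun ℓ' h => h3 ℓ' (h.starSubdivision u v)⟩
      · refine ih Δ hΔ fun p hp => ?_
        have h1 := hle p hp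
        have h2 : ℓ p.1 - ℓ p.2 ≠ (M + 1 : ℕ) := fun h => hex ⟨p, hp, h⟩
        push_cast at h1 h2
        omega

/-- There is a complete unimodular fan none of whose cones is cut by any of finitely many
rational hyperplanes. -/
theorem exists_isUnimodularSubdivision (L : Finset ((Fin n → ℕ) →+ ℤ)) :
    ∃ Δ : Finset (Finset (Fin n → ℕ)), IsUnimodularSubdivision Δ ∧
      ∀ ℓ ∈ L, HasConstantSigns ℓ Δ := by
  classical
  induction L using Finset.induction_on with
  | empty => exact ⟨_, isUnimodularSubdivision_single, by simp⟩
  | insert ℓ L _ ih =>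
    obtain ⟨Δ, hΔ, hL⟩ := ih
    obtain ⟨Δ', h1, h2, h3⟩ := exists_hasConstantSigns_of_le (ℓ := ℓ)
      ((cutPairs ℓ Δ).sup fun p => (ℓ p.1 - ℓ p.2).natAbs) Δ hΔ fun p hp =>
        Int.le_natAbs.trans (Int.ofNat_le.2
          (Finset.le_sup (f := fun p => (ℓ p.1 - ℓ p.2).natAbs) hp))
    refine ⟨Δ', h1, fun ℓ' hℓ' => ?_⟩
    rcases Finset.mem_insert.1 hℓ' with rfl | h
    · exact h2
    · exact h3 ℓ' (hL ℓ' h)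

/-! ### Polyhedra with finitely many minimal exponents -/

/-- The linear form `⟨w, ·⟩`. -/
noncomputable def dotForm (w : Fin n → ℝ) : (Fin n → ℝ) →ₗ[ℝ] ℝ := dotProductBilin ℝ ℝ w

theorem dotForm_apply (w x : Fin n → ℝ) : dotForm w x = w ⬝ᵥ x := rfl

/-- `P` behaves like `conv A + ℝ≥0ⁿ`: it contains `A` and is stable under adding nonnegative
vectors, and lower bounds over `A` of nonnegative linear forms are lower bounds over `P`. -/
structure IsPolyhedronOf (P : Set (Fin n → ℝ)) (A : Finset (Fin n → ℕ)) : Prop where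
  nonempty : A.Nonempty
  toReal_mem : ∀ α ∈ A, toReal α ∈ P
  add_mem : ∀ x ∈ P, ∀ r : Fin n → ℝ, 0 ≤ r → x + r ∈ P
  le_dotProduct : ∀ w : Fin n → ℝ, 0 ≤ w → ∀ c : ℝ, (∀ α ∈ A, c ≤ w ⬝ᵥ toReal α) →
    ∀ y ∈ P, c ≤ w ⬝ᵥ y

/-- Dickson's lemma: a Newton polyhedron is spanned by the finitely many minimal exponents. -/
theorem exists_isPolyhedronOf_newtonPolyhedron {𝕜 : Type*} [Field 𝕜]
    {f : MvPowerSeries (Fin n) 𝕜} (hf : f ≠ 0) :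
    ∃ A : Finset (Fin n → ℕ), IsPolyhedronOf (newtonPolyhedron f) A := by
  classical
  let E : Set (Fin n → ℕ) := {α | toReal α ∈ supp f}
  have hE : ∀ x ∈ supp f, ∃ α ∈ E, x = toReal α := by
    rintro x ⟨α, hα, rfl⟩
    exact ⟨α, ⟨α, hα, rfl⟩, rfl⟩
  have hfin : {α | Minimal (· ∈ E) α}.Finite :=
    WellQuasiOrderedLE.finite_of_isAntichain (setOfPred_minimal_antichain _)
  have hmin : ∀ x ∈ supp f, ∃ α, Minimal (· ∈ E) α ∧ toReal α ≤ x := by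
    intro x hx
    obtain ⟨α, hα, rfl⟩ := hE x hx
    obtain ⟨β, hβ, hmin⟩ := exists_minimal_le_of_wellFoundedLT (· ∈ E) α hα
    exact ⟨β, hmin, fun i => Nat.cast_le.2 (hβ i)⟩
  have hsub : supp f ⊆ newtonPolyhedron f := fun x hx =>
    ⟨x, subset_convexHull ℝ _ hx, 0, le_refl (0 : Fin n → ℝ), add_zero x⟩
  refine ⟨hfin.toFinset, ?_, ?_, ?_, ?_⟩
  · obtain ⟨α, hα⟩ := (MvPowerSeries.ne_zero_iff_exists_coeff_ne_zero f).1 hf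
    obtain ⟨β, hβ, -⟩ := hmin (toReal α) ⟨α, hα, rfl⟩
    exact ⟨β, hfin.mem_toFinset.2 hβ⟩
  · intro α hα
    exact hsub (hfin.mem_toFinset.1 hα).1
  · rintro _ ⟨z, hz, s, hs, rfl⟩ r hr
    exact ⟨z, hz, s + r, add_nonneg hs hr, (add_assoc z s r).symm⟩
  · rintro w hw c hc _ ⟨z, hz, r, hr, rfl⟩
    have hconv : Convex ℝ {z | c ≤ dotForm w z} :=
      convex_halfSpace_ge (dotForm w).isLinear c
    have h1 : convexHull ℝ (supp f) ⊆ {z | c ≤ dotForm w z} := by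
      refine convexHull_min (fun x hx => ?_) hconv
      obtain ⟨α, hα, hle⟩ := hmin x hx
      exact (hc α (hfin.mem_toFinset.2 hα)).trans (dotProduct_le_dotProduct_of_nonneg_left hle hw)
    have h2 : c ≤ w ⬝ᵥ z := h1 hz
    have h3 : 0 ≤ w ⬝ᵥ r := dotProduct_nonneg_of_nonneg hw hr
    change c ≤ w ⬝ᵥ (z + r)
    rw [dotProduct_add]
    linarith

/-- The normal cone of `P` at `a`, without the origin. -/
def normalCone (P : Set (Fin n → ℝ)) (a : Fin n → ℝ) : Set (Fin n → ℝ) :=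
  {w | w ∈ ambientCone n ∧ a ∈ face P w}

theorem coneOf_subset_normalCone {P V : Set (Fin n → ℝ)} {a : Fin n → ℝ}
    (haP : a ∈ P) (hV : V ⊆ normalCone P a) : coneOf V ⊆ normalCone P a := by
  intro x hx
  refine ⟨coneOf_subset_ambientCone (fun v hv => (hV hv).1) hx, haP, fun y hy => ?_⟩
  refine hull_induction (p := fun x => x ⬝ᵥ a ≤ x ⬝ᵥ y) (fun v hv => (hV hv).2.2 y hy) (by simp)
    (fun x z _ _ h1 h2 => ?_) (fun t x ht _ h => ?_) hx.1
  · rw [add_dotProduct, add_dotProduct]; exact add_le_add h1 h2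
  · rw [smul_dotProduct, smul_dotProduct]; exact mul_le_mul_of_nonneg_left h ht

theorem dotProduct_eq_of_mem_face {P : Set (Fin n → ℝ)} {w x y : Fin n → ℝ}
    (hx : x ∈ face P w) (hy : y ∈ face P w) : w ⬝ᵥ x = w ⬝ᵥ y :=
  le_antisymm (hx.2 y hy.1) (hy.2 x hx.1)

theorem mem_face_of_le {P : Set (Fin n → ℝ)} {w x y : Fin n → ℝ}
    (hx : x ∈ face P w) (hy : y ∈ P) (h : w ⬝ᵥ y ≤ w ⬝ᵥ x) : y ∈ face P w :=
  ⟨hy, fun z hz => h.trans (hx.2 z hz)⟩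

/-! ### Facets and generators of normal cones -/

theorem dotForm_ne_zero {v : Fin n → ℝ} (hv : v ≠ 0) : dotForm v ≠ 0 := fun h =>
  hv (dotProduct_self_eq_zero.1 (LinearMap.congr_fun h v))

theorem finrank_ker_dotForm {v : Fin n → ℝ} (hv : v ≠ 0) :
    Module.finrank ℝ (LinearMap.ker (dotForm v)) + 1 = n := by
  simpa using Module.Dual.finrank_ker_add_one_of_ne_zero (dotForm_ne_zero hv)

theorem affDim_face_eq {P : Set (Fin n → ℝ)} {a v : Fin n → ℝ} (ha : a ∈ face P v) :
    affDim (face P v) =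
      Module.finrank ℝ (Submodule.span ℝ ((fun y => y - a) '' face P v)) := by
  rw [affDim, direction_affineSpan, vectorSpan_eq_span_vsub_set_right ℝ ha]
  rfl

theorem span_face_le_ker {P : Set (Fin n → ℝ)} {a v w : Fin n → ℝ}
    (h : ∀ y ∈ face P v, w ⬝ᵥ y = w ⬝ᵥ a) :
    Submodule.span ℝ ((fun y => y - a) '' face P v) ≤ LinearMap.ker (dotForm w) := by
  rw [Submodule.span_le]
  rintro _ ⟨y, hy, rfl⟩
  simp [dotForm_apply, dotProduct_sub, h y hy]

/-- A vector orthogonal to a facet is a multiple of its normal vector. -/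
theorem exists_eq_smul_of_orthogonal_facet {P : Set (Fin n → ℝ)} {a v g : Fin n → ℝ}
    (hv : v ≠ 0) (ha : a ∈ face P v) (hdim : affDim (face P v) + 1 = n)
    (hg : ∀ y ∈ face P v, g ⬝ᵥ y = g ⬝ᵥ a) : ∃ t : ℝ, g = t • v := by
  have hvv : v ⬝ᵥ v ≠ 0 := fun h => hv (dotProduct_self_eq_zero.1 h)
  have hle := span_face_le_ker (a := a) fun y hy => dotProduct_eq_of_mem_face hy ha
  have heq : Submodule.span ℝ ((fun y => y - a) '' face P v) = LinearMap.ker (dotForm v) := by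
    refine Submodule.eq_of_le_of_finrank_eq hle ?_
    rw [← affDim_face_eq ha]
    have := finrank_ker_dotForm hv
    omega
  -- the component of `g` orthogonal to `v` is parallel to the facet, hence orthogonal to `g`
  set u := g - ((v ⬝ᵥ g) / (v ⬝ᵥ v)) • v with hu
  have hvu : v ⬝ᵥ u = 0 := by
    rw [hu, dotProduct_sub, dotProduct_smul, smul_eq_mul, div_mul_cancel₀ _ hvv, sub_self]
  have hgu : g ⬝ᵥ u = 0 := by
    have h1 : u ∈ LinearMap.ker (dotForm v) := hvu
    rw [← heq] at h1
    exact span_face_le_ker hg h1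
  have huu : u ⬝ᵥ u = 0 := by
    conv_lhs => rw [hu, sub_dotProduct, ← hu]
    rw [smul_dotProduct, hgu, hvu, smul_zero, sub_zero]
  exact ⟨_, sub_eq_zero.1 (dotProduct_self_eq_zero.1 huu)⟩

/-- If the face of `v` is not a facet, there is a direction besides `v` orthogonal to it. -/
theorem exists_orthogonal_of_not_facet {P : Set (Fin n → ℝ)} {a v : Fin n → ℝ}
    (hv : v ≠ 0) (ha : a ∈ face P v) (hdim : affDim (face P v) + 1 ≠ n) :
    ∃ u : Fin n → ℝ, u ≠ 0 ∧ v ⬝ᵥ u = 0 ∧ ∀ y ∈ face P v, u ⬝ᵥ y = u ⬝ᵥ a := by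
  set D := Submodule.span ℝ ((fun y => y - a) '' face P v) with hD
  have hle : D ≤ LinearMap.ker (dotForm v) :=
    span_face_le_ker fun y hy => dotProduct_eq_of_mem_face hy ha
  have hlt : D ⊔ Submodule.span ℝ {v} < ⊤ := by
    refine lt_top_iff_ne_top.2 fun htop => ?_
    have h1 := Submodule.finrank_add_le_finrank_add_finrank D (Submodule.span ℝ {v})
    rw [htop, finrank_top, Module.finrank_fin_fun, finrank_span_singleton hv] at h1
    have h2 := Submodule.finrank_mono hle
    have h3 := finrank_ker_dotForm hv
    rw [affDim_face_eq ha, ← hD] at hdim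
    omega
  obtain ⟨φ, hφ, hker⟩ := Submodule.exists_le_ker_of_lt_top _ hlt
  have hφu : ∀ x, φ x = (fun i => φ (Pi.single i 1)) ⬝ᵥ x := fun x => by
    conv_lhs => rw [← Finset.univ_sum_single x]
    rw [map_sum, dotProduct]
    refine Finset.sum_congr rfl fun i _ => ?_
    rw [mul_comm, ← smul_eq_mul, ← map_smul, ← Pi.single_smul, smul_eq_mul, mul_one]
  refine ⟨fun i => φ (Pi.single i 1), fun h0 => hφ ?_, ?_, fun y hy => ?_⟩
  · refine LinearMap.ext fun x => ?_
    rw [hφu, h0, zero_dotProduct, LinearMap.zero_apply]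
  · rw [dotProduct_comm, ← hφu]
    exact hker (Submodule.mem_sup_right (Submodule.mem_span_singleton_self v))
  · rw [← sub_eq_zero, ← dotProduct_sub, ← hφu]
    exact hker (Submodule.mem_sup_left (Submodule.subset_span ⟨y, hy, rfl⟩))

/-- Directions orthogonal to the face of `v` do not leave the normal cone at once. -/
theorem IsPolyhedronOf.eventually_mem_normalCone {P : Set (Fin n → ℝ)} {A : Finset (Fin n → ℕ)}
    (hP : IsPolyhedronOf P A) {a v u : Fin n → ℝ} (hv : v ∈ normalCone P a)
    (hvu : v ⬝ᵥ u = 0) (hu : ∀ y ∈ face P v, u ⬝ᵥ y = u ⬝ᵥ a) :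
    ∀ᶠ t : ℝ in nhds 0, v + t • u ∈ normalCone P a := by
  have key : ∀ p q : ℝ, 0 ≤ p → (p = 0 → q = 0) → ∀ᶠ t : ℝ in nhds 0, 0 ≤ p + t * q := by
    intro p q hp hpq
    rcases hp.eq_or_lt with rfl | hp
    · simp [hpq rfl]
    · have hc : Filter.Tendsto (fun t : ℝ => p + t * q) (nhds 0) (nhds (p + 0 * q)) :=
        (Continuous.tendsto (by fun_prop) 0)
      rw [zero_mul, add_zero] at hc
      exact (hc.eventually (lt_mem_nhds hp)).mono fun t ht => le_of_lt ht
  -- where `v` has coordinate `0`, its face contains a ray in that direction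
  have h1 : ∀ᶠ t : ℝ in nhds 0, ∀ i, 0 ≤ v i + t * u i := by
    refine Filter.eventually_all.2 fun i => key _ _ (hv.1.1 i) fun hi => ?_
    have h2 := hu (a + Pi.single i 1) (mem_face_of_le hv.2
      (hP.add_mem a hv.2.1 _ (Pi.single_nonneg.2 zero_le_one)) (by simp [dotProduct_add, hi]))
    simpa [dotProduct_add] using h2
  have h2 : ∀ᶠ t : ℝ in nhds 0, ∀ α ∈ A,
      0 ≤ v ⬝ᵥ (toReal α - a) + t * (u ⬝ᵥ (toReal α - a)) := by
    refine (Filter.eventually_all_finset A).2 fun α hα => key _ _ ?_ fun h0 => ?_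
    · rw [dotProduct_sub, sub_nonneg]
      exact hv.2.2 _ (hP.toReal_mem α hα)
    · rw [dotProduct_sub, sub_eq_zero] at h0 ⊢
      exact hu _ (mem_face_of_le hv.2 (hP.toReal_mem α hα) h0.le)
  filter_upwards [h1, h2] with t h1 h2
  have hnn : 0 ≤ v + t • u := fun i => h1 i
  refine ⟨⟨hnn, fun h0 => ?_⟩, hv.2.1, hP.le_dotProduct _ hnn _ fun α hα => ?_⟩
  · have h3 : v ⬝ᵥ (v + t • u) = 0 := by
      rw [Set.mem_singleton_iff.1 h0, dotProduct_zero]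
    rw [dotProduct_add, dotProduct_smul, hvu, smul_zero, add_zero] at h3
    exact hv.1.2 (dotProduct_self_eq_zero.1 h3)
  · have h3 := h2 α hα
    simp only [dotProduct_sub, add_dotProduct, smul_dotProduct, smul_eq_mul] at h3 ⊢
    linarith

/-- An indispensable generator of a normal cone is the normal vector of a facet: otherwise it
would be the midpoint of two vectors of the cone in other directions. -/
theorem IsPolyhedronOf.affDim_face_of_notMem {P : Set (Fin n → ℝ)} {A : Finset (Fin n → ℕ)}
    (hP : IsPolyhedronOf P A) {a v : Fin n → ℝ} {G : Set (Fin n → ℝ)} (hvG : v ∈ G)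
    (hG : coneOf G = normalCone P a) (hv : v ∈ normalCone P a)
    (hmin : v ∉ PointedCone.hull ℝ (G \ {v})) (hGa : G ⊆ ambientCone n) :
    affDim (face P v) + 1 = n := by
  by_contra hdim
  obtain ⟨u, hu0, hvu, hu⟩ := exists_orthogonal_of_not_facet hv.1.2 hv.2 hdim
  obtain ⟨ε, hε, hball⟩ :=
    Metric.eventually_nhds_iff.1 (hP.eventually_mem_normalCone hv hvu hu)
  have hmem : ∀ t : ℝ, |t| < ε → ∃ c : ℝ, 0 ≤ c ∧
      ∃ z ∈ PointedCone.hull ℝ (G \ {v}), v + t • u = c • v + z := by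
    intro t ht
    have h1 := hball (y := t) (by simpa using ht)
    rw [← hG, ← Set.insert_eq_of_mem hvG, ← Set.insert_sdiff_singleton] at h1
    obtain ⟨c, z, hz, h2⟩ := Submodule.mem_span_insert.1 h1.1
    exact ⟨c.1, c.2, z, hz, h2⟩
  obtain ⟨c, hc, z, hz, h1⟩ := hmem (ε / 2) (by rw [abs_of_pos (by linarith)]; linarith)
  obtain ⟨d, hd, z', hz', h2⟩ := hmem (-(ε / 2)) (by
    rw [abs_neg, abs_of_pos (by linarith)]; linarith)
  have hsum : z + z' = (2 - (c + d)) • v := by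
    have h3 : z = v + (ε / 2) • u - c • v := by rw [h1]; abel
    have h4 : z' = v + (-(ε / 2)) • u - d • v := by rw [h2]; abel
    rw [h3, h4]
    module
  -- either `v` is a combination of the other generators, or `z = z' = 0` and `u` is parallel to `v`
  rcases lt_or_ge (c + d) 2 with hlt | hge
  · refine hmin ?_
    have h3 := smul_mem_hull (Submodule.add_mem _ hz hz') (inv_nonneg.2 (sub_pos.2 hlt).le)
    rwa [hsum, inv_smul_smul₀ (sub_pos.2 hlt).ne'] at h3
  · have hG' : G \ {v} ⊆ ambientCone n := Set.sdiff_subset.trans hGa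
    have hz0 := hull_subset_nonneg hG' hz
    have hz0' := hull_subset_nonneg hG' hz'
    have h3 : z = 0 := by
      refine le_antisymm (fun i => ?_) hz0
      have h4 := congrFun hsum i
      have h5 : (2 - (c + d)) * v i ≤ 0 :=
        mul_nonpos_of_nonpos_of_nonneg (by linarith) (hv.1.1 i)
      have h6 := hz0' i
      simp only [Pi.add_apply, Pi.smul_apply, smul_eq_mul, Pi.zero_apply] at h4 h6 ⊢
      linarith
    have h4 := congrArg (u ⬝ᵥ ·) h1
    simp only [h3, add_zero, dotProduct_add, dotProduct_smul, dotProduct_comm u v, hvu,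
      smul_eq_mul, mul_zero, zero_add] at h4
    rcases mul_eq_zero.1 h4 with h5 | h5
    · linarith
    · exact hu0 (dotProduct_self_eq_zero.1 h5)

theorem eq_of_toReal_eq_smul {v w : Fin n → ℕ} (hv : Finset.univ.gcd v = 1)
    (hw : Finset.univ.gcd w = 1) {t : ℝ} (h : toReal w = t • toReal v) : w = v := by
  have h1 : ∀ i j, w i * v j = v i * w j := fun i j => by
    have hi : (w i : ℝ) = t * v i := congrFun h i
    have hj : (w j : ℝ) = t * v j := congrFun h j
    have : (w i : ℝ) * v j = v i * w j := by rw [hi, hj]; ring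
    exact_mod_cast this
  funext i
  have h2 : Finset.univ.gcd (fun j => w i * v j) = Finset.univ.gcd fun j => v i * w j :=
    Finset.gcd_congr rfl fun j _ => h1 i j
  rw [Finset.gcd_mul_left, Finset.gcd_mul_left] at h2
  simpa [hv, hw] using h2

/-- The primitive normal vector of a facet through `a` is needed in every generator set of the
normal cone of `a` which consists of primitive vectors. -/
theorem notMem_coneOf_of_facet {P : Set (Fin n → ℝ)} {a : Fin n → ℝ} {v : Fin n → ℕ}
    (hv : Finset.univ.gcd v = 1) (ha : a ∈ face P (toReal v))
    (hdim : affDim (face P (toReal v)) + 1 = n) {T : Set (Fin n → ℝ)}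
    (hT : ∀ x ∈ T, a ∈ face P x ∧ ∃ w : Fin n → ℕ, x = toReal w ∧ Finset.univ.gcd w = 1)
    (hvT : toReal v ∉ T) : toReal v ∉ coneOf T := by
  rintro ⟨hmem, hv0⟩
  have hnn : ∀ x ∈ PointedCone.hull ℝ T, ∀ y ∈ P, 0 ≤ x ⬝ᵥ (y - a) := by
    intro x hx y hy
    refine hull_induction (p := fun x => 0 ≤ x ⬝ᵥ (y - a)) (fun w hw => ?_) (by simp)
      (fun x z _ _ h1 h2 => ?_) (fun t x ht _ h => ?_) hx
    · rw [dotProduct_sub, sub_nonneg]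
      exact (hT w hw).1.2 y hy
    · rw [add_dotProduct]; exact add_nonneg h1 h2
    · rw [smul_dotProduct]; exact mul_nonneg ht h
  -- only the origin of the cone is orthogonal to the whole facet
  have key : (∀ y ∈ face P (toReal v), toReal v ⬝ᵥ (y - a) = 0) → toReal v = 0 := by
    refine hull_induction
      (p := fun x => (∀ y ∈ face P (toReal v), x ⬝ᵥ (y - a) = 0) → x = 0) ?_ (fun _ => rfl)
      ?_ ?_ hmem
    · intro x hx h
      obtain ⟨-, w, rfl, hw⟩ := hT x hx
      obtain ⟨t, ht⟩ := exists_eq_smul_of_orthogonal_facet hv0 ha hdim (g := toReal w)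
        fun y hy => sub_eq_zero.1 ((dotProduct_sub _ _ _).symm.trans (h y hy))
      exact absurd (eq_of_toReal_eq_smul hv hw ht ▸ hx) hvT
    · intro x z hx hz ihx ihz h
      have hsum : ∀ y ∈ face P (toReal v), x ⬝ᵥ (y - a) = 0 ∧ z ⬝ᵥ (y - a) = 0 :=
        fun y hy => by
          have h1 := h y hy
          rw [add_dotProduct] at h1
          exact (add_eq_zero_iff_of_nonneg (hnn x hx y hy.1) (hnn z hz y hy.1)).1 h1
      rw [ihx fun y hy => (hsum y hy).1, ihz fun y hy => (hsum y hy).2, add_zero]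
    · intro t x ht hx ihx h
      rcases ht.eq_or_lt with rfl | ht
      · exact zero_smul ℝ x
      · rw [ihx fun y hy => ?_, smul_zero]
        have h1 := h y hy
        rw [smul_dotProduct, smul_eq_mul] at h1
        exact (mul_eq_zero.1 h1).resolve_left ht.ne'
  refine hv0 (key fun y hy => ?_)
  rw [dotProduct_sub, dotProduct_eq_of_mem_face hy ha, sub_self]

/-! ### Subdivisions of the normal fan -/

theorem comb_mem_hull {c : (Fin n → ℕ) →₀ ℝ} (hc : ∀ v, 0 ≤ c v) {S : Set (Fin n → ℕ)}
    (hS : ∀ v, c v ≠ 0 → v ∈ S) : comb c ∈ PointedCone.hull ℝ (toReal '' S) := by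
  rw [comb, Finsupp.linearCombination_apply]
  refine sum_mem fun v hv => smul_mem_hull (PointedCone.subset_hull ?_) (hc v)
  exact ⟨v, hS v (Finsupp.mem_support_iff.1 hv), rfl⟩

theorem exists_comb_eq_of_mem_hull {S : Set (Fin n → ℕ)} {x : Fin n → ℝ}
    (hx : x ∈ PointedCone.hull ℝ (toReal '' S)) :
    ∃ c, (∀ v, 0 ≤ c v) ∧ (∀ v, c v ≠ 0 → v ∈ S) ∧ comb c = x := by
  refine hull_induction
    (p := fun x => ∃ c, (∀ v, 0 ≤ c v) ∧ (∀ v, c v ≠ 0 → v ∈ S) ∧ comb c = x) ?_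
    ⟨0, fun _ => le_rfl, fun _ h => absurd rfl h, map_zero _⟩ ?_ ?_ hx
  · rintro _ ⟨v, hv, rfl⟩
    refine ⟨Finsupp.single v 1, Finsupp.single_nonneg.2 zero_le_one, fun w hw => ?_, ?_⟩
    · rw [Finsupp.single_apply_ne_zero] at hw
      exact hw.1 ▸ hv
    · rw [comb_single, one_smul]
  · rintro x y - - ⟨c, hc, hcS, rfl⟩ ⟨d, hd, hdS, rfl⟩
    refine ⟨c + d, fun v => add_nonneg (hc v) (hd v), fun v hv => ?_, map_add _ _ _⟩
    by_contra hvS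
    rw [Finsupp.add_apply, not_imp_comm.1 (hcS v) hvS, not_imp_comm.1 (hdS v) hvS] at hv
    exact hv (add_zero 0)
  · rintro t x ht - ⟨c, hc, hcS, rfl⟩
    exact ⟨t • c, fun v => mul_nonneg ht (hc v),
      fun v hv => hcS v (right_ne_zero_of_mul hv), map_smul _ _ _⟩

/-- Uniqueness of coefficients makes two cones meet in the cone of their common generators. -/
theorem IsUnimodularSubdivision.coneOf_inter {Δ : Finset (Finset (Fin n → ℕ))}
    (hΔ : IsUnimodularSubdivision Δ) {S T : Finset (Fin n → ℕ)} (hS : S ∈ Δ) (hT : T ∈ Δ) :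
    coneOf (toReal '' (S : Set (Fin n → ℕ))) ∩ coneOf (toReal '' (T : Set (Fin n → ℕ))) =
      coneOf (toReal '' (S ∩ T : Set (Fin n → ℕ))) := by
  refine Set.Subset.antisymm ?_ (Set.subset_inter
    (coneOf_mono (Set.image_mono Set.inter_subset_left))
    (coneOf_mono (Set.image_mono Set.inter_subset_right)))
  rintro x ⟨⟨h1, h0⟩, ⟨h2, -⟩⟩
  obtain ⟨c, hc, hcS, rfl⟩ := exists_comb_eq_of_mem_hull h1
  obtain ⟨d, hd, hdT, hcd⟩ := exists_comb_eq_of_mem_hull h2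
  obtain rfl := hΔ.coeff_unique d c ⟨hd, T, hT, hdT⟩ ⟨hc, S, hS, hcS⟩ hcd
  exact ⟨comb_mem_hull hc fun v hv => ⟨hcS v hv, hdT v hv⟩, h0⟩

/-- The form `v ↦ ⟨v, α - β⟩`. -/
def diffForm (α β : Fin n → ℕ) : (Fin n → ℕ) →+ ℤ where
  toFun v := ∑ i, (v i : ℤ) * ((α i : ℤ) - β i)
  map_zero' := by simp
  map_add' u v := by simp [add_mul, Finset.sum_add_distrib]

theorem cast_diffForm (α β v : Fin n → ℕ) :
    (diffForm α β v : ℝ) = toReal v ⬝ᵥ toReal α - toReal v ⬝ᵥ toReal β := by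
  simp [diffForm, dotProduct, toReal, mul_sub]

/-- The sum of the vectors of a basis selects a single point of `P` if all of them attain their
minimum there. -/
theorem IsUnimodular.exists_face_eq_singleton (hn : 1 ≤ n) {P S : Set (Fin n → ℝ)}
    (hS : IsUnimodular S) {a : Fin n → ℝ} (ha : ∀ s ∈ S, a ∈ face P s) :
    ∃ w ∈ ambientCone n, face P w = {a} := by
  have hsum : ∀ y, (∑ s ∈ hS.finite.toFinset, s) ⬝ᵥ y = ∑ s ∈ hS.finite.toFinset, s ⬝ᵥ y :=
    fun y => sum_dotProduct _ _ _
  have hmem : ∀ s, s ∈ hS.finite.toFinset ↔ s ∈ S := fun s => hS.finite.mem_toFinset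
  have hnn : ∀ s ∈ hS.finite.toFinset, 0 ≤ s := fun s hs =>
    (hS.subset_ambientCone ((hmem s).1 hs)).1
  obtain ⟨s₀, hs₀⟩ : S.Nonempty := by
    refine Set.nonempty_of_ncard_ne_zero ?_
    rw [hS.ncard_eq]; omega
  refine ⟨∑ s ∈ hS.finite.toFinset, s, ⟨?_, fun h => ?_⟩, ?_⟩
  · exact Finset.sum_nonneg hnn
  · rw [Set.mem_singleton_iff, Finset.sum_eq_zero_iff_of_nonneg hnn] at h
    exact (hS.subset_ambientCone hs₀).2 (h s₀ ((hmem s₀).2 hs₀))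
  · have hle : ∀ y ∈ P, ∀ s ∈ hS.finite.toFinset, s ⬝ᵥ a ≤ s ⬝ᵥ y :=
      fun y hy s hs => (ha s ((hmem s).1 hs)).2 y hy
    have haP := (ha s₀ hs₀).1
    have haf : a ∈ face P (∑ s ∈ hS.finite.toFinset, s) := ⟨haP, fun y hy => by
      rw [hsum, hsum]; exact Finset.sum_le_sum (hle y hy)⟩
    refine Set.Subset.antisymm (fun y hy => ?_) (Set.singleton_subset_iff.2 haf)
    have heq := dotProduct_eq_of_mem_face haf hy
    rw [hsum, hsum, Finset.sum_eq_sum_iff_of_le (hle y hy.1)] at heq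
    have hspan : Submodule.span ℝ S ≤ LinearMap.ker (dotForm (y - a)) := by
      refine Submodule.span_le.2 fun s hs => ?_
      change (y - a) ⬝ᵥ s = 0
      rw [dotProduct_comm, dotProduct_sub, heq s ((hmem s).2 hs), sub_self]
    rw [hS.span_eq_top] at hspan
    have h0 : (y - a) ⬝ᵥ (y - a) = 0 := hspan (Submodule.mem_top (x := y - a))
    exact sub_eq_zero.1 (dotProduct_self_eq_zero.1 h0)

/-- The generator sets in `Δ` of the cones contained in the normal cone of `P` at `a`. -/
def localCones (P : Set (Fin n → ℝ)) (Δ : Finset (Finset (Fin n → ℕ))) (a : Fin n → ℝ) :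
    Set (Set (Fin n → ℝ)) :=
  {T | (∃ S ∈ Δ, T = toReal '' (S : Set (Fin n → ℕ))) ∧ ∀ x ∈ T, a ∈ face P x}

/-- `Δ` refines the normal fan of `P`. -/
structure RefinesNormalFan (P : Set (Fin n → ℝ)) (Δ : Finset (Finset (Fin n → ℕ))) : Prop
    extends IsUnimodularSubdivision Δ where
  exists_vertex : ∀ S ∈ Δ, ∃ a ∈ vertices P,
    toReal '' (S : Set (Fin n → ℕ)) ∈ localCones P Δ a

/-- If no hyperplane `⟨·, α - β⟩ = 0` with `α` and `β` in `A` cuts a cone, then one element of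
`A` is minimal on the whole cone. -/
theorem IsPolyhedronOf.exists_refinesNormalFan (hn : 1 ≤ n) {P : Set (Fin n → ℝ)}
    {A : Finset (Fin n → ℕ)} (hP : IsPolyhedronOf P A) : ∃ Δ, RefinesNormalFan P Δ := by
  classical
  obtain ⟨Δ, hΔ, hsign⟩ := exists_isUnimodularSubdivision
    ((A ×ˢ A).image fun p => diffForm p.1 p.2)
  refine ⟨Δ, hΔ, fun S hS => ?_⟩
  obtain ⟨α, hα, hmin⟩ := A.exists_min_image (fun α => ∑ s ∈ S, toReal s ⬝ᵥ toReal α) hP.nonempty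
  have hface : ∀ x ∈ toReal '' (S : Set (Fin n → ℕ)), toReal α ∈ face P x := by
    rintro _ ⟨s, hs, rfl⟩
    refine ⟨hP.toReal_mem α hα, hP.le_dotProduct _ (toReal_nonneg s) _ fun β hβ => ?_⟩
    rw [← sub_nonpos, ← cast_diffForm]
    rcases hsign (diffForm α β) (Finset.mem_image.2
      ⟨(α, β), Finset.mem_product.2 ⟨hα, hβ⟩, rfl⟩) S hS with h | h
    · have h1 : ∑ s ∈ S, (diffForm α β s : ℝ) ≤ 0 := by
        simp only [cast_diffForm, Finset.sum_sub_distrib]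
        linarith [hmin β hβ]
      have h2 : ∀ s ∈ S, (0 : ℝ) ≤ diffForm α β s := fun s hs => by exact_mod_cast h s hs
      exact ((Finset.sum_eq_zero_iff_of_nonneg h2).1
        (le_antisymm h1 (Finset.sum_nonneg h2)) s hs).le
    · exact_mod_cast h s hs
  exact ⟨toReal α, (hΔ.isUnimodular S hS).exists_face_eq_singleton hn hface,
    ⟨S, hS, rfl⟩, hface⟩

theorem mem_of_mem_vertices {P : Set (Fin n → ℝ)} {a : Fin n → ℝ} (ha : a ∈ vertices P) :
    a ∈ P := by
  obtain ⟨w, -, h⟩ := ha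
  exact (h ▸ Set.mem_singleton a : a ∈ face P w).1

theorem IsPolyhedronOf.finite_vertices {P : Set (Fin n → ℝ)} {A : Finset (Fin n → ℕ)}
    (hP : IsPolyhedronOf P A) : (vertices P).Finite := by
  refine (A.finite_toSet.image toReal).subset ?_
  rintro a ⟨w, hw, h⟩
  obtain ⟨α, hα, hmin⟩ := A.exists_min_image (fun α => w ⬝ᵥ toReal α) hP.nonempty
  have : toReal α ∈ face P w := ⟨hP.toReal_mem α hα, hP.le_dotProduct w hw.1 _ hmin⟩
  rw [h] at this
  exact ⟨α, hα, this⟩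

theorem vertexGenerators_subset_normalCone (P : Set (Fin n → ℝ)) (a : Fin n → ℝ) :
    vertexGenerators P a ⊆ normalCone P a := by
  rintro _ ⟨⟨w, rfl, hw, -⟩, ha⟩
  refine ⟨toReal_mem_ambientCone ?_, ha⟩
  rintro rfl
  exact zero_ne_one ((Finset.gcd_eq_zero_iff.2 fun _ _ => rfl).symm.trans hw)

theorem isMinimalGenerators_vertexGenerators (P : Set (Fin n → ℝ))
    (a : Fin n → ℝ) :
    IsMinimalGenerators (vertexGenerators P a) := by
  rintro _ ⟨⟨w, rfl, hw, -, hdim⟩, haf⟩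
  refine notMem_coneOf_of_facet hw haf hdim ?_ fun h => h.2 rfl
  rintro x ⟨⟨⟨v, rfl, hv, -⟩, hav⟩, -⟩
  exact ⟨hav, v, rfl, hv⟩

namespace RefinesNormalFan

variable {P : Set (Fin n → ℝ)} {Δ : Finset (Finset (Fin n → ℕ))}

theorem finite_localCones (a : Fin n → ℝ) : (localCones P Δ a).Finite := by
  refine (Δ.finite_toSet.image
    fun S : Finset (Fin n → ℕ) => toReal '' (S : Set (Fin n → ℕ))).subset ?_
  rintro T ⟨⟨S, hS, rfl⟩, -⟩
  exact ⟨S, hS, rfl⟩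

theorem isUnimodular_of_mem (h : RefinesNormalFan P Δ) {a : Fin n → ℝ} {T : Set (Fin n → ℝ)}
    (hT : T ∈ localCones P Δ a) : IsUnimodular T := by
  obtain ⟨⟨S, hS, rfl⟩, -⟩ := hT
  exact h.isUnimodular S hS

theorem subset_normalCone (h : RefinesNormalFan P Δ) {a : Fin n → ℝ} {T : Set (Fin n → ℝ)}
    (hT : T ∈ localCones P Δ a) : T ⊆ normalCone P a :=
  fun x hx => ⟨(h.isUnimodular_of_mem hT).subset_ambientCone hx, hT.2 x hx⟩

theorem exists_mem_coneOf (h : RefinesNormalFan P Δ) {x : Fin n → ℝ} (hx : x ∈ ambientCone n) :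
    ∃ a ∈ vertices P, ∃ T ∈ localCones P Δ a, x ∈ coneOf T := by
  obtain ⟨c, ⟨hc, S, hS, hcS⟩, rfl⟩ := h.exists_coeff x hx.1
  obtain ⟨a, ha, hT⟩ := h.exists_vertex S hS
  exact ⟨a, ha, _, hT, comb_mem_hull hc hcS, hx.2⟩

/-- The normal cone at a vertex is covered by the cones of `Δ` contained in it. A point near it
in the interior of the normal cone lies in no other normal cone, and finite unions of simplicial
cones are closed. -/
theorem normalCone_eq (h : RefinesNormalFan P Δ) {a : Fin n → ℝ} (ha : a ∈ vertices P) :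
    normalCone P a = ⋃₀ (coneOf '' localCones P Δ a) := by
  have haP := mem_of_mem_vertices ha
  refine Set.Subset.antisymm (fun x hx => ?_) ?_
  · obtain ⟨w, hw, hwa⟩ := ha
    have hclosed : IsClosed (⋃ T ∈ localCones P Δ a,
        (PointedCone.hull ℝ T : Set (Fin n → ℝ))) :=
      (finite_localCones a).isClosed_biUnion fun T hT => (h.isUnimodular_of_mem hT).isClosed_hull
    have hlim : Filter.Tendsto (fun t : ℝ => x + t • w) (nhdsWithin 0 (Set.Ioi 0)) (nhds x) := by
      have : Filter.Tendsto (fun t : ℝ => x + t • w) (nhds 0) (nhds (x + (0 : ℝ) • w)) :=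
        Continuous.tendsto (by fun_prop) 0
      rw [zero_smul, add_zero] at this
      exact this.mono_left nhdsWithin_le_nhds
    have hev : ∀ᶠ t : ℝ in nhdsWithin 0 (Set.Ioi 0), x + t • w ∈ ⋃ T ∈ localCones P Δ a,
        (PointedCone.hull ℝ T : Set (Fin n → ℝ)) := by
      filter_upwards [self_mem_nhdsWithin] with t ht
      have ht : 0 < t := ht
      have hamb : x + t • w ∈ ambientCone n := by
        refine mem_ambientCone.2 ⟨add_nonneg hx.1.1 (smul_nonneg ht.le hw.1), fun h0 => hx.1.2 ?_⟩
        exact ((add_eq_zero_iff_of_nonneg hx.1.1 (smul_nonneg ht.le hw.1)).1 h0).1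
      obtain ⟨b, hb, T, hT, hmem⟩ := h.exists_mem_coneOf hamb
      have hbP := mem_of_mem_vertices hb
      have hbf := (coneOf_subset_normalCone hbP (h.subset_normalCone hT) hmem).2
      have hba : b ∈ face P w := by
        have h1 := hbf.2 a haP
        have h2 := hx.2.2 b hbP
        simp only [add_dotProduct, smul_dotProduct, smul_eq_mul] at h1
        exact mem_face_of_le (hwa ▸ Set.mem_singleton a) hbP
          (le_of_mul_le_mul_left (by linarith) ht)
      rw [hwa] at hba
      obtain rfl := hba
      exact Set.mem_biUnion hT hmem.1
    obtain ⟨T, hT, hxT⟩ := Set.mem_iUnion₂.1 (hclosed.mem_of_tendsto hlim hev)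
    exact ⟨_, ⟨T, hT, rfl⟩, hxT, hx.1.2⟩
  · rintro x ⟨_, ⟨T, hT, rfl⟩, hxT⟩
    exact coneOf_subset_normalCone haP (h.subset_normalCone hT) hxT

theorem sUnion_subset_normalCone (h : RefinesNormalFan P Δ) {a : Fin n → ℝ} :
    ⋃₀ localCones P Δ a ⊆ normalCone P a :=
  Set.sUnion_subset fun _ hT => h.subset_normalCone hT

theorem coneOf_sUnion (h : RefinesNormalFan P Δ) {a : Fin n → ℝ} (ha : a ∈ vertices P) :
    coneOf (⋃₀ localCones P Δ a) = normalCone P a := by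
  refine Set.Subset.antisymm
    (coneOf_subset_normalCone (mem_of_mem_vertices ha) h.sUnion_subset_normalCone) ?_
  rw [h.normalCone_eq ha]
  rintro x ⟨_, ⟨T, hT, rfl⟩, hxT⟩
  exact coneOf_mono (Set.subset_sUnion_of_mem hT) hxT

theorem finite_sUnion (h : RefinesNormalFan P Δ) (a : Fin n → ℝ) :
    (⋃₀ localCones P Δ a).Finite :=
  (finite_localCones a).sUnion fun _ hT => (h.isUnimodular_of_mem hT).finite

theorem exists_primitive (h : RefinesNormalFan P Δ) {a x : Fin n → ℝ}
    (hx : x ∈ ⋃₀ localCones P Δ a) :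
    ∃ w : Fin n → ℕ, x = toReal w ∧ Finset.univ.gcd w = 1 := by
  obtain ⟨T, hT, hxT⟩ := hx
  have hu := h.isUnimodular_of_mem hT
  obtain ⟨w, -, rfl⟩ := hu.subset_toReal hxT
  exact ⟨w, rfl, hu.gcd_eq_one hxT⟩

/-- A minimal generator set of the normal cone consists of normal vectors of facets. -/
theorem vertexCone_eq {A : Finset (Fin n → ℕ)} (hP : IsPolyhedronOf P A)
    (h : RefinesNormalFan P Δ) {a : Fin n → ℝ} (ha : a ∈ vertices P) :
    vertexCone P a = normalCone P a := by
  refine Set.Subset.antisymm (coneOf_subset_normalCone (mem_of_mem_vertices ha)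
    (vertexGenerators_subset_normalCone P a)) ?_
  have hfin : {G | G ⊆ ⋃₀ localCones P Δ a ∧ coneOf G = normalCone P a}.Finite :=
    (h.finite_sUnion a).finite_subsets.subset fun _ hG => hG.1
  obtain ⟨G, ⟨hGsub, hG⟩, hmin⟩ :=
    hfin.exists_minimal ⟨_, subset_rfl, h.coneOf_sUnion ha⟩
  have hGn := hGsub.trans h.sUnion_subset_normalCone
  rw [← hG]
  refine coneOf_mono fun v hv => ?_
  have hvn := hGn hv
  obtain ⟨w, rfl, hw⟩ := h.exists_primitive (hGsub hv)
  refine ⟨⟨w, rfl, hw, ⟨a, hvn.2⟩, ?_⟩, hvn.2⟩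
  refine hP.affDim_face_of_notMem hv hG hvn (fun hcon => ?_) fun x hx => (hGn hx).1
  have heq : coneOf (G \ {toReal w}) = normalCone P a := by
    have h1 := Submodule.span_insert_eq_span hcon
    rw [Set.insert_sdiff_singleton, Set.insert_eq_of_mem hv] at h1
    rw [← hG, coneOf, coneOf, PointedCone.hull, PointedCone.hull, h1]
  exact (hmin ⟨Set.sdiff_subset.trans hGsub, heq⟩ Set.sdiff_subset hv).2 rfl

theorem vertexGenerators_subset (h : RefinesNormalFan P Δ) {a : Fin n → ℝ}
    (ha : a ∈ vertices P) : vertexGenerators P a ⊆ ⋃₀ localCones P Δ a := by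
  intro v hv
  have hvn := vertexGenerators_subset_normalCone P a hv
  obtain ⟨⟨w, rfl, hw, -, hdim⟩, haf⟩ := hv
  by_contra hcon
  refine notMem_coneOf_of_facet hw haf hdim (fun x hx => ?_) hcon ((h.coneOf_sUnion ha).ge hvn)
  exact ⟨(h.sUnion_subset_normalCone hx).2, h.exists_primitive hx⟩

theorem finrank_vertexGenerators {A : Finset (Fin n → ℕ)} (hP : IsPolyhedronOf P A)
    (h : RefinesNormalFan P Δ) {a : Fin n → ℝ} (ha : a ∈ vertices P) :
    Set.finrank ℝ (vertexGenerators P a) = n := by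
  obtain ⟨w, hw, hwa⟩ := id ha
  have hwn : w ∈ normalCone P a := ⟨hw, hwa ▸ Set.mem_singleton a⟩
  rw [h.normalCone_eq ha] at hwn
  obtain ⟨_, ⟨T, hT, rfl⟩, -⟩ := hwn
  have hle : Submodule.span ℝ T ≤ Submodule.span ℝ (vertexGenerators P a) := by
    refine Submodule.span_le.2 fun x hx => ?_
    have h1 := h.subset_normalCone hT hx
    rw [← vertexCone_eq hP h ha] at h1
    exact PointedCone.hull_le_span ℝ _ h1.1
  rw [(h.isUnimodular_of_mem hT).span_eq_top, top_le_iff] at hle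
  rw [Set.finrank, hle, finrank_top, Module.finrank_fin_fun]

end RefinesNormalFan

/-! ### The fan of vertex cones and its refinements -/

theorem sub_apply_nonpos_of_mem_normalCone {P : Set (Fin n → ℝ)} {a b x : Fin n → ℝ}
    (hb : b ∈ P) (hx : x ∈ normalCone P a) : dotForm (a - b) x ≤ 0 := by
  rw [dotForm_apply, dotProduct_comm, dotProduct_sub, sub_nonpos]
  exact hx.2.2 b hb

/-- Two normal cones meet in the part of one of them where `a` and `b` have the same value. -/
theorem mem_normalCone_iff_of_mem {P : Set (Fin n → ℝ)} {a b x : Fin n → ℝ}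
    (hb : b ∈ P) (hx : x ∈ normalCone P a) : x ∈ normalCone P b ↔ dotForm (a - b) x = 0 := by
  rw [dotForm_apply, dotProduct_comm, dotProduct_sub, sub_eq_zero]
  exact ⟨fun h => dotProduct_eq_of_mem_face hx.2 h.2,
    fun h => ⟨hx.1, mem_face_of_le hx.2 hb h.ge⟩⟩

theorem normalCone_inter {P : Set (Fin n → ℝ)} {a b : Fin n → ℝ} (hb : b ∈ P) :
    normalCone P a ∩ normalCone P b = {x ∈ normalCone P a | dotForm (a - b) x = 0} :=
  Set.ext fun _ => and_congr_right fun hx => mem_normalCone_iff_of_mem hb hx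

theorem isConeFace_normalCone_inter {P : Set (Fin n → ℝ)} {a b : Fin n → ℝ} (hb : b ∈ P)
    (hne : (normalCone P a ∩ normalCone P b).Nonempty)
    (hsmul : ∀ x ∈ normalCone P a, ∀ t : ℝ, 0 < t → t • x ∈ normalCone P a) :
    IsConeFace (normalCone P a ∩ normalCone P b) (normalCone P a) :=
  (isConeFace_iff (fun _ hx => hx.1) hsmul).2 ⟨hne, dotForm (a - b),
    fun _ hx => sub_apply_nonpos_of_mem_normalCone hb hx, normalCone_inter hb⟩

theorem isSimplicialCone_of_isUnimodular (hn : 1 ≤ n) {S : Set (Fin n → ℝ)}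
    (hS : IsUnimodular S) : IsSimplicialCone n (coneOf S) :=
  ⟨hn, S, hS.finite, hS.subset_ambientCone, hS.ncard_eq, hS.finrank_eq, rfl⟩

namespace RefinesNormalFan

variable {P : Set (Fin n → ℝ)} {Δ : Finset (Finset (Fin n → ℕ))} {A : Finset (Fin n → ℕ)}

theorem ambientCone_eq (hP : IsPolyhedronOf P A) (h : RefinesNormalFan P Δ) :
    ambientCone n = ⋃₀ vertexCones P := by
  ext x
  constructor
  · intro hx
    obtain ⟨a, ha, T, hT, hxT⟩ := h.exists_mem_coneOf hx
    refine ⟨_, ⟨a, ha, rfl⟩, ?_⟩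
    rw [vertexCone_eq hP h ha, h.normalCone_eq ha]
    exact ⟨_, ⟨T, hT, rfl⟩, hxT⟩
  · rintro ⟨_, ⟨a, ha, rfl⟩, hx⟩
    rw [vertexCone_eq hP h ha] at hx
    exact hx.1

theorem isPolyhedralFan_vertexCones (hP : IsPolyhedronOf P A) (h : RefinesNormalFan P Δ) :
    IsPolyhedralFan n (vertexCones P) (ambientCone n) := by
  refine ⟨hP.finite_vertices.image _, ?_, h.ambientCone_eq hP, ?_⟩
  · rintro _ ⟨a, ha, rfl⟩
    exact ⟨_, (h.finite_sUnion a).subset (h.vertexGenerators_subset ha),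
      fun x hx => (vertexGenerators_subset_normalCone P a hx).1,
      finrank_vertexGenerators hP h ha, rfl⟩
  · rintro _ ⟨a, ha, rfl⟩ _ ⟨b, hb, rfl⟩ - hne
    have hsmul : ∀ a ∈ vertices P, ∀ x ∈ normalCone P a, ∀ t : ℝ, 0 < t →
        t • x ∈ normalCone P a := by
      intro a ha x hx t ht
      rw [← vertexCone_eq hP h ha] at hx ⊢
      exact smul_mem_coneOf hx ht
    rw [vertexCone_eq hP h ha, vertexCone_eq hP h hb] at hne ⊢
    refine ⟨isConeFace_normalCone_inter (mem_of_mem_vertices hb) hne (hsmul a ha), ?_⟩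
    rw [Set.inter_comm] at hne ⊢
    exact isConeFace_normalCone_inter (mem_of_mem_vertices ha) hne (hsmul b hb)

theorem isConeFace_coneOf_inter (h : RefinesNormalFan P Δ) {a b : Fin n → ℝ}
    {S T : Set (Fin n → ℝ)} (hS : S ∈ localCones P Δ a) (hT : T ∈ localCones P Δ b)
    (hne : (coneOf S ∩ coneOf T).Nonempty) : IsConeFace (coneOf S ∩ coneOf T) (coneOf S) := by
  have hu := h.isUnimodular_of_mem hS
  obtain ⟨⟨S, hSΔ, rfl⟩, -⟩ := hS
  obtain ⟨⟨T, hTΔ, rfl⟩, -⟩ := hT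
  rw [h.coneOf_inter hSΔ hTΔ] at hne ⊢
  exact isConeFace_of_subset hu.subset_ambientCone hu.linearIndepOn
    (Set.image_mono Set.inter_subset_left) hne

theorem isRefinementChoice_localCones (hn : 1 ≤ n) (hP : IsPolyhedronOf P A)
    (h : RefinesNormalFan P Δ) : IsRefinementChoice P (localCones P Δ) := by
  intro a ha
  refine ⟨⟨⋃₀ localCones P Δ a,
    Set.sUnion_subset fun T hT => (h.isUnimodular_of_mem hT).subset_toReal,
    isMinimalGenerators_vertexGenerators P a, h.finite_sUnion a, ?_, finite_localCones a, ?_,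
    (Set.union_eq_self_of_subset_left (h.vertexGenerators_subset ha)).symm⟩,
    fun T hT => h.isUnimodular_of_mem hT⟩
  · exact h.sUnion_subset_normalCone.trans (vertexCone_eq hP h ha).ge
  · rw [finrank_vertexGenerators hP h ha]
    refine ⟨(finite_localCones a).image _, ?_, ?_, ?_⟩
    · rintro _ ⟨T, hT, rfl⟩
      exact isSimplicialCone_of_isUnimodular hn (h.isUnimodular_of_mem hT)
    · exact (vertexCone_eq hP h ha).trans (h.normalCone_eq ha)
    · rintro _ ⟨S, hS, rfl⟩ _ ⟨T, hT, rfl⟩ - hne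
      refine ⟨h.isConeFace_coneOf_inter hS hT hne, ?_⟩
      rw [Set.inter_comm] at hne ⊢
      exact h.isConeFace_coneOf_inter hT hS hne

/-- A cone of `Δ` which contains the sum of some generators of another one contains each of
them as a generator. -/
theorem facesWithin_subset (hP : IsPolyhedronOf P A) (h : RefinesNormalFan P Δ)
    {a b : Fin n → ℝ} (hb : b ∈ vertices P) :
    facesWithin (localCones P Δ a) (vertexCone P a ∩ vertexCone P b) ⊆
      facesWithin (localCones P Δ b) (vertexCone P a ∩ vertexCone P b) := by
  classical
  rintro F ⟨hF, T, hT, hface⟩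
  refine ⟨hF, ?_⟩
  have hne := hface.1
  have hu := h.isUnimodular_of_mem hT
  obtain ⟨B, hBT, rfl⟩ := hface.exists_subset hu.subset_ambientCone
  obtain ⟨⟨S, hS, rfl⟩, -⟩ := hT
  -- the coefficients of the sum of the elements of `B`
  let c : (Fin n → ℕ) →₀ ℝ := Finsupp.onFinset (S.filter fun v => toReal v ∈ B)
    (fun v => if v ∈ S.filter fun v => toReal v ∈ B then 1 else 0) fun v hv => by
      by_contra h0; exact hv (if_neg h0)
  have hc : ∀ v, c v = if v ∈ S.filter fun v => toReal v ∈ B then 1 else 0 := fun v => rfl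
  have hcnn : ∀ v, 0 ≤ c v := fun v => by rw [hc]; split_ifs <;> norm_num
  have hcB : ∀ v, c v ≠ 0 → v ∈ S ∧ toReal v ∈ B := fun v hv => by
    rw [hc] at hv
    by_contra h0
    exact hv (if_neg (fun h1 => h0 (Finset.mem_filter.1 h1)))
  have hc1 : ∀ v ∈ S, toReal v ∈ B → c v = 1 := fun v hvS hvB => by
    rw [hc, if_pos (Finset.mem_filter.2 ⟨hvS, hvB⟩)]
  have hcoeff : IsCoeff Δ c := ⟨hcnn, S, hS, fun v hv => (hcB v hv).1⟩
  have hmem : comb c ∈ coneOf B := by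
    constructor
    · refine Submodule.span_mono ?_ (comb_mem_hull hcnn (S := {v | toReal v ∈ B})
        fun v hv => (hcB v hv).2)
      rintro _ ⟨v, hv, rfl⟩
      exact hv
    · intro h0
      have hc0 : c = 0 := h.coeff_unique c 0 hcoeff
        ⟨fun _ => le_rfl, S, hS, fun _ hv => absurd rfl hv⟩
        ((Set.mem_singleton_iff.1 h0).trans (map_zero comb).symm)
      have hB : B = ∅ := by
        refine Set.eq_empty_of_forall_notMem fun x hx => ?_
        obtain ⟨v, hv, rfl⟩ := hBT hx
        have := hc1 v hv hx
        rw [hc0] at this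
        exact zero_ne_one this
      obtain ⟨x, hx⟩ := hne
      refine hx.2 ?_
      have hx1 := hx.1
      rw [hB] at hx1
      simpa using hx1
  have hmemb := (hF hmem).2
  rw [vertexCone_eq hP h hb, h.normalCone_eq hb] at hmemb
  obtain ⟨_, ⟨T, hT, rfl⟩, hcT⟩ := hmemb
  refine ⟨T, hT, ?_⟩
  have hu' := h.isUnimodular_of_mem hT
  obtain ⟨⟨S', hS', rfl⟩, -⟩ := hT
  obtain ⟨d, hd, hdS, hdc⟩ := exists_comb_eq_of_mem_hull hcT.1
  obtain rfl := h.coeff_unique d c ⟨hd, S', hS', hdS⟩ hcoeff hdc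
  refine isConeFace_of_subset hu'.subset_ambientCone hu'.linearIndepOn (fun x hx => ?_) hne
  obtain ⟨v, hv, rfl⟩ := hBT hx
  refine ⟨v, hdS v ?_, rfl⟩
  rw [hc1 v hv hx]
  exact one_ne_zero

theorem agreeOnOverlaps_localCones (hP : IsPolyhedronOf P A) (h : RefinesNormalFan P Δ) :
    AgreeOnOverlaps P (localCones P Δ) := by
  intro a ha b hb
  refine Set.Subset.antisymm (h.facesWithin_subset hP hb) ?_
  rw [Set.inter_comm]
  exact h.facesWithin_subset hP ha

end RefinesNormalFan

section RefinementChoice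

variable {P : Set (Fin n → ℝ)} {R : (Fin n → ℝ) → Set (Set (Fin n → ℝ))}

theorem IsRefinementChoice.vertexCone_eq (hR : IsRefinementChoice P R) {a : Fin n → ℝ}
    (ha : a ∈ vertices P) : vertexCone P a = ⋃₀ (coneOf '' R a) := by
  obtain ⟨⟨W, -, -, -, -, -, hfan, -⟩, -⟩ := hR a ha
  exact hfan.2.2.1

theorem IsRefinementChoice.coneOf_subset (hR : IsRefinementChoice P R) {a : Fin n → ℝ}
    (ha : a ∈ vertices P) {S : Set (Fin n → ℝ)} (hS : S ∈ R a) :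
    coneOf S ⊆ vertexCone P a := by
  rw [hR.vertexCone_eq ha]
  exact Set.subset_sUnion_of_mem ⟨S, hS, rfl⟩

theorem IsRefinementChoice.sUnion_refinedVertexCones (hR : IsRefinementChoice P R) :
    ⋃₀ refinedVertexCones P R = ⋃₀ vertexCones P := by
  ext x
  constructor
  · rintro ⟨_, ⟨a, ha, S, hS, rfl⟩, hx⟩
    exact ⟨_, ⟨a, ha, rfl⟩, hR.coneOf_subset ha hS hx⟩
  · rintro ⟨_, ⟨a, ha, rfl⟩, hx⟩
    rw [hR.vertexCone_eq ha] at hx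
    obtain ⟨_, ⟨S, hS, rfl⟩, hxS⟩ := hx
    exact ⟨_, ⟨a, ha, S, hS, rfl⟩, hxS⟩

/-- The trace of `C(S)` on the vertex cone of `b` is a face of some cone `C(T')` of the refinement
of that vertex cone; in it, `C(T)` cuts out a face of the common face of `C(T')` and `C(T)`. -/
theorem IsRefinementChoice.isConeFace_inter (hR : IsRefinementChoice P R)
    (hagree : AgreeOnOverlaps P R)
    (hcone : ∀ a ∈ vertices P, vertexCone P a = normalCone P a) {a b : Fin n → ℝ}
    (ha : a ∈ vertices P) (hb : b ∈ vertices P) {S T : Set (Fin n → ℝ)} (hS : S ∈ R a)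
    (hT : T ∈ R b) (hne : (coneOf S ∩ coneOf T).Nonempty) :
    IsConeFace (coneOf S ∩ coneOf T) (coneOf T) := by
  have hSu := (hR a ha).2 S hS
  have hTu := (hR b hb).2 T hT
  have hSa : coneOf S ⊆ normalCone P a := hcone a ha ▸ hR.coneOf_subset ha hS
  have hTb : coneOf T ⊆ normalCone P b := hcone b hb ▸ hR.coneOf_subset hb hT
  have hF : coneOf S ∩ normalCone P b ∈
      facesWithin (R a) (vertexCone P a ∩ vertexCone P b) := by
    rw [hcone a ha, hcone b hb]
    refine ⟨Set.inter_subset_inter_left _ hSa, S, hS,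
      (isConeFace_coneOf_iff hSu.subset_ambientCone).2
        ⟨hne.mono (Set.inter_subset_inter_right _ hTb), dotForm (a - b), fun x hx =>
          sub_apply_nonpos_of_mem_normalCone (mem_of_mem_vertices hb) (hSa hx), ?_⟩⟩
    exact Set.ext fun x => and_congr_right fun hx =>
      mem_normalCone_iff_of_mem (mem_of_mem_vertices hb) (hSa hx)
  rw [hagree a ha b hb] at hF
  obtain ⟨-, T', hT', hface⟩ := hF
  have hTu' := (hR b hb).2 T' hT'
  obtain ⟨-, l₂, hl₂, hFeq⟩ := (isConeFace_coneOf_iff hTu'.subset_ambientCone).1 hface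
  have hST : ∀ x ∈ coneOf T, (x ∈ coneOf S ↔ x ∈ coneOf T' ∧ l₂ x = 0) := fun x hx => by
    have h1 : x ∈ coneOf S ∩ normalCone P b ↔ x ∈ {x ∈ coneOf T' | l₂ x = 0} := by rw [hFeq]
    exact ⟨fun h => h1.1 ⟨h, hTb hx⟩, fun h => (h1.2 h).1⟩
  -- the common face of `C(T')` and `C(T)`, which may be equal
  have hcommon : IsConeFace (coneOf T' ∩ coneOf T) (coneOf T) := by
    have hne' : (coneOf T' ∩ coneOf T).Nonempty := by
      obtain ⟨x, hxS, hxT⟩ := hne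
      exact ⟨x, ((hST x hxT).1 hxS).1, hxT⟩
    by_cases heq : coneOf T' = coneOf T
    · rw [heq, Set.inter_self] at hne' ⊢
      exact isConeFace_of_subset hTu.subset_ambientCone hTu.linearIndepOn subset_rfl hne'
    · obtain ⟨⟨W, -, -, -, -, -, hfan, -⟩, -⟩ := hR b hb
      exact (hfan.2.2.2 _ ⟨T', hT', rfl⟩ _ ⟨T, hT, rfl⟩ heq hne').2
  obtain ⟨-, l₁, hl₁, hHeq⟩ := (isConeFace_coneOf_iff hTu.subset_ambientCone).1 hcommon
  have hT'T : ∀ x ∈ coneOf T, (x ∈ coneOf T' ↔ l₁ x = 0) := fun x hx => by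
    have h1 : x ∈ coneOf T' ∩ coneOf T ↔ x ∈ {x ∈ coneOf T | l₁ x = 0} := by rw [hHeq]
    exact ⟨fun h => (h1.1 ⟨h, hx⟩).2, fun h => (h1.2 ⟨hx, h⟩).1⟩
  have heq : coneOf S ∩ coneOf T = {x ∈ {x ∈ coneOf T | l₁ x = 0} | l₂ x = 0} := by
    ext x
    constructor
    · rintro ⟨hxS, hxT⟩
      obtain ⟨h1, h2⟩ := (hST x hxT).1 hxS
      exact ⟨⟨hxT, (hT'T x hxT).1 h1⟩, h2⟩
    · rintro ⟨⟨hxT, h1⟩, h2⟩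
      exact ⟨(hST x hxT).2 ⟨(hT'T x hxT).2 h1, h2⟩, hxT⟩
  rw [heq] at hne ⊢
  exact isConeFace_sep_sep hTu.subset_ambientCone hTu.linearIndepOn hl₁
    (fun x hx h0 => hl₂ x ((hT'T x hx).2 h0)) hne

theorem IsRefinementChoice.isSimplicialFan (hn : 1 ≤ n) (hR : IsRefinementChoice P R)
    (hagree : AgreeOnOverlaps P R) (hfin : (vertices P).Finite)
    (hcone : ∀ a ∈ vertices P, vertexCone P a = normalCone P a)
    (hunion : ambientCone n = ⋃₀ refinedVertexCones P R) :
    IsSimplicialFan n (refinedVertexCones P R) (ambientCone n) := by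
  refine ⟨?_, ?_, hunion, ?_⟩
  · have hfin' : (⋃ a ∈ vertices P, coneOf '' R a).Finite := by
      refine hfin.biUnion fun a ha => ?_
      obtain ⟨⟨W, -, -, -, -, hRfin, -⟩, -⟩ := hR a ha
      exact hRfin.image _
    refine hfin'.subset ?_
    rintro _ ⟨a, ha, S, hS, rfl⟩
    exact Set.mem_biUnion ha ⟨S, hS, rfl⟩
  · rintro _ ⟨a, ha, S, hS, rfl⟩
    exact isSimplicialCone_of_isUnimodular hn ((hR a ha).2 S hS)
  · rintro _ ⟨a, ha, S, hS, rfl⟩ _ ⟨b, hb, T, hT, rfl⟩ - hne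
    refine ⟨?_, hR.isConeFace_inter hagree hcone ha hb hS hT hne⟩
    rw [Set.inter_comm] at hne ⊢
    exact hR.isConeFace_inter hagree hcone hb ha hT hS hne

end RefinementChoice

end NewtonFan

theorem mainTheorem5 {𝕜 : Type*} [Field 𝕜] [CharZero 𝕜] {n : ℕ} (hn : 1 ≤ n)
    (f : MvPowerSeries (Fin n) 𝕜) (hf : f ≠ 0) :
    NewtonFan.IsPolyhedralFan n (NewtonFan.vertexCones (NewtonFan.newtonPolyhedron f))
        (NewtonFan.ambientCone n) ∧
      (∃ R : (Fin n → ℝ) → Set (Set (Fin n → ℝ)),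
        NewtonFan.IsRefinementChoice (NewtonFan.newtonPolyhedron f) R ∧
        NewtonFan.AgreeOnOverlaps (NewtonFan.newtonPolyhedron f) R) ∧
      ∀ R : (Fin n → ℝ) → Set (Set (Fin n → ℝ)),
        NewtonFan.IsRefinementChoice (NewtonFan.newtonPolyhedron f) R →
        NewtonFan.ambientCone n =
            ⋃₀ NewtonFan.refinedVertexCones (NewtonFan.newtonPolyhedron f) R ∧
          (NewtonFan.AgreeOnOverlaps (NewtonFan.newtonPolyhedron f) R →
            NewtonFan.IsSimplicialFan n
              (NewtonFan.refinedVertexCones (NewtonFan.newtonPolyhedron f) R)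
              (NewtonFan.ambientCone n)) := by
  obtain ⟨A, hP⟩ := NewtonFan.exists_isPolyhedronOf_newtonPolyhedron hf
  obtain ⟨Δ, hΔ⟩ := hP.exists_refinesNormalFan hn
  refine ⟨hΔ.isPolyhedralFan_vertexCones hP, ⟨_, hΔ.isRefinementChoice_localCones hn hP,
    hΔ.agreeOnOverlaps_localCones hP⟩, fun R hR => ?_⟩
  have hunion := (hΔ.ambientCone_eq hP).trans hR.sUnion_refinedVertexCones.symm
  exact ⟨hunion, fun hagree => hR.isSimplicialFan hn hagree hP.finite_vertices
    (fun a ha => NewtonFan.RefinesNormalFan.vertexCone_eq hP hΔ ha) hunion⟩
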